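/- Let $G$ be a real Lie group which is the semidirect product $G=U\rtimes A$ of closed subgroups $U$ (normal) and $A$, where $U$ and $A$ are contractible, $A$ is abelian, and $U$ is real unipotent, i.e. isomorphic as a topological group to a closed group of real upper triangular $n\times n$ matrices with all diagonal entries equal to $1$ (for some $n$). Equip $G$ with any left-invariant Riemannian metric and the associated distance. Assume that $G$ is tame: there are an element $a\in A$ and a compact set $\Omega\subset U$ (a vacuum subset for $a$) such that for every compact $K\subset U$ there is an integer $n>0$ with $\mathrm{Ad}(a)^nK\subset\Omega$, where $\mathrm{Ad}(a)x=a^{-1}xa$. Then $G$ is Lipschitz 1-connected: there is a constant $C$ such that for every Lipschitz loop $\gamma:S^1\to G$, $$\inf\{\mathrm{Lip}(f)\;:\;f:D^2\to G,\ f|_{S^1}=\gamma\}\le C\,\mathrm{Lip}(\gamma),$$ where $S^1\subset D^2\subset\mathbb{C}$ are the unit circle and the closed unit disk with the Euclidean metric, and $\mathrm{Lip}$ denotes the optimal Lipschitz constant ($\infty$ for a map that is not Lipschitz). -/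

import Mathlib

open scoped Manifold ContDiff NNReal ENNReal Topology Bundle

noncomputable section

/-- The optimal Lipschitz constant `Lip(f)`, equal to `∞` if `f` is not Lipschitz. -/
def lipConst {X Y : Type*} [PseudoEMetricSpace X] [PseudoEMetricSpace Y] (f : X → Y) : ℝ≥0∞ :=
  ⨅ (K : ℝ≥0) (_ : LipschitzWith K f), (K : ℝ≥0∞)

/-- `f : D² → X` restricts to `γ` on `S¹ = ∂D²`. -/
def IsFilling {X : Type*} (γ : Metric.sphere (0 : ℂ) 1 → X)
    (f : Metric.closedBall (0 : ℂ) 1 → X) : Prop :=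
  ∀ z : Metric.sphere (0 : ℂ) 1, f ⟨z, Metric.sphere_subset_closedBall z.2⟩ = γ z

/-- The filling span of a loop: the infimum of `Lip(f)` over all fillings `f` of `γ`. -/
def fillingSpan {X : Type*} [PseudoEMetricSpace X] (γ : Metric.sphere (0 : ℂ) 1 → X) : ℝ≥0∞ :=
  ⨅ (f : Metric.closedBall (0 : ℂ) 1 → X) (_ : IsFilling γ f), lipConst f

/-- `X` is Lipschitz 1-connected: the filling span of every Lipschitz loop is at most a constant
times its Lipschitz constant. -/
def LipschitzOneConnected (X : Type*) [PseudoEMetricSpace X] : Prop :=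
  ∃ C : ℝ≥0, ∀ γ : Metric.sphere (0 : ℂ) 1 → X, (∃ K : ℝ≥0, LipschitzWith K γ) →
    fillingSpan γ ≤ C * lipConst γ

/-- A topological group is real unipotent if it is isomorphic, as a topological group, to a closed
group of real upper triangular matrices with all diagonal entries equal to `1`. -/
def IsRealUnipotent (U : Type*) [Group U] [TopologicalSpace U] : Prop :=
  ∃ (n : ℕ) (ρ : U →* Matrix (Fin n) (Fin n) ℝ), Topology.IsClosedEmbedding ρ ∧
    ∀ u, (ρ u).IsUpperTriangular ∧ ∀ i, ρ u i i = 1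

/-- The topological group `G` is the (internal) semidirect product `U ⋊ A` of its closed subgroups
`U` and `A`, where `U` is normal, real unipotent and contractible, and `A` is abelian and
contractible. -/
structure IsUnipotentByAbelian {G : Type*} [Group G] [TopologicalSpace G]
    (U A : Subgroup G) : Prop where
  isClosed_left : IsClosed (U : Set G)
  isClosed_right : IsClosed (A : Set G)
  normal : U.Normal
  isComplement : U.IsComplement' A
  unipotent : IsRealUnipotent U
  comm : IsMulCommutative A
  contractible_left : ContractibleSpace U
  contractible_right : ContractibleSpace A

/-- `Ω` is a vacuum subset of `U` for `a`: `Ω ⊆ U` is compact, and every compact `K ⊆ U` is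
mapped into `Ω` by some positive power of the conjugation `Ad(a) : x ↦ a⁻¹ x a`. -/
def IsVacuumSubset {G : Type*} [Group G] [TopologicalSpace G] (U : Subgroup G) (a : G)
    (Ω : Set G) : Prop :=
  IsCompact Ω ∧ Ω ⊆ U ∧ ∀ K : Set G, IsCompact K → K ⊆ U →
    ∃ n : ℕ, 0 < n ∧ (fun x ↦ a⁻¹ * x * a)^[n] '' K ⊆ Ω

/-- `U ⋊ A` is tame: some element of `A` has a vacuum subset. -/
def IsTame {G : Type*} [Group G] [TopologicalSpace G] (U A : Subgroup G) : Prop :=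
  ∃ a ∈ A, ∃ Ω : Set G, IsVacuumSubset U a Ω

/-- The Riemannian metric on the Lie group `G` is left invariant: the differentials of all left
translations are isometries between tangent spaces. -/
def IsLeftInvariantMetric (E : Type*) [NormedAddCommGroup E] [NormedSpace ℝ E]
    (G : Type*) [Group G] [TopologicalSpace G] [ChartedSpace E G]
    [Bundle.RiemannianBundle (fun x : G ↦ TangentSpace 𝓘(ℝ, E) x)] : Prop :=
  ∀ (g x : G) (v : TangentSpace 𝓘(ℝ, E) x),
    ‖mfderiv 𝓘(ℝ, E) 𝓘(ℝ, E) (fun y : G ↦ g * y) x v‖ = ‖v‖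

end

/-! Write |g| for the distance from g to 1. Right translation by a path a^s in A moves every point a
distance proportional to s. It acts on the U-part of a point as conjugation by a^s, which contracts
U exponentially. After translation by left multiplication, a loop of Lipschitz constant K starts at
1 and has U-part of norm O(K). Although U may be distorted in G, the U-part becomes smaller than a
fixed θ after a time S = O(K). The outer annulus of the disk carries this translation. On the inner
disk the A-part, which lives in a normed space, shrinks linearly to a point. The U-part keeps
flowing, with time reparametrized by -log σ / c so that its size decays like σ. Radial speed and
angular Lipschitz constant divided by the radius are then O(K), as polar coordinates require
(`lipschitzWith_polar`, `IsMetricSplitting.lipschitzOneConnected`).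

All of this uses only a few properties of the metric: left invariance, the length property and
Gleason's two conditions (escape of powers, quadratically small commutators). Gleason's conditions
come from a chart and pass to any subgroup, so A is treated without giving it a Lie structure. Its
Lipschitz one-parameter subgroups form a normed space V, and evaluation at time 1 is a covering V →
A, hence bijective because A is contractible (`OneParameterSubgroup.bijective_exp`). This gives e :
V → G and a Lipschitz homomorphism ℓ : G → V with kernel U.

Tameness gives only a compact attracting set. A limit of elements that fail to contract to 1 would
have all its powers in Ω, and a nontrivial unipotent element has unbounded powers. Hence balls of U
contract to 1, and escape of powers turns this into a linear contraction by 1/2 near 1. The linear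
bound on S comes from cutting an element of U into short pieces: each U-increment is distorted by at
most an exponential in |u|, which exponential contraction beats in time proportional to |u|
(`exists_conjExp_small`). -/

open Manifold Set Filter

/-! ### Riemannian distance and multiplication in a chart -/

section RiemannianInterface

variable {E : Type*} [NormedAddCommGroup E] [NormedSpace ℝ E]
  {G : Type*} [Group G]

/-- Left translations do not increase the Riemannian distance of a left-invariant metric. -/
theorem riemannianEDist_mul_left_le [TopologicalSpace G] [ChartedSpace E G]
    [LieGroup 𝓘(ℝ, E) ∞ G] [Bundle.RiemannianBundle (fun x : G ↦ TangentSpace 𝓘(ℝ, E) x)]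
    (hG : IsLeftInvariantMetric E G) (g x y : G) :
    riemannianEDist 𝓘(ℝ, E) (g * x) (g * y) ≤ riemannianEDist 𝓘(ℝ, E) x y := by
  have hmul : ContMDiff 𝓘(ℝ, E) 𝓘(ℝ, E) ∞ (fun z : G ↦ g * z) := contMDiff_mul_left
  refine le_of_forall_gt fun r hr ↦ ?_
  obtain ⟨γ, h0, h1, hγ, hlen⟩ := exists_lt_of_riemannianEDist_lt hr
  refine lt_of_le_of_lt ?_ hlen
  refine (riemannianEDist_le_pathELength (γ := fun t ↦ g * γ t) (a := 0) (b := 1)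
    ((hmul.of_le (by simp)).comp_contMDiffOn hγ) (by simp [h0]) (by simp [h1])
    zero_le_one).trans_eq ?_
  rw [pathELength_eq_lintegral_mfderivWithin_Icc, pathELength_eq_lintegral_mfderivWithin_Icc]
  refine MeasureTheory.setLIntegral_congr_fun measurableSet_Icc fun t ht ↦ ?_
  have hc : mfderivWithin 𝓘(ℝ, ℝ) 𝓘(ℝ, E) ((fun z : G ↦ g * z) ∘ γ) (Icc 0 1) t =
      (mfderiv 𝓘(ℝ, E) 𝓘(ℝ, E) (fun z : G ↦ g * z) (γ t)) ∘L
        (mfderivWithin 𝓘(ℝ, ℝ) 𝓘(ℝ, E) γ (Icc 0 1) t) := by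
    apply mfderiv_comp_mfderivWithin
    · exact hmul.mdifferentiableAt (by simp)
    · exact hγ.mdifferentiableOn one_ne_zero t ht
    · rw [uniqueMDiffWithinAt_iff_uniqueDiffWithinAt]
      exact uniqueDiffOn_Icc zero_lt_one t ht
  have h2 := hG g (γ t) (mfderivWithin 𝓘(ℝ, ℝ) 𝓘(ℝ, E) γ (Icc 0 1) t 1)
  have hc1 : mfderivWithin 𝓘(ℝ, ℝ) 𝓘(ℝ, E) (fun t ↦ g * γ t) (Icc 0 1) t 1 =
      (mfderiv 𝓘(ℝ, E) 𝓘(ℝ, E) (fun z : G ↦ g * z) (γ t))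
        (mfderivWithin 𝓘(ℝ, ℝ) 𝓘(ℝ, E) γ (Icc 0 1) t 1) := DFunLike.congr_fun hc 1
  simp only [hc1]
  rw [← ofReal_norm, ← ofReal_norm, h2]


/-- The distance of a left-invariant Riemannian metric is left invariant. -/
theorem isIsometricSMul_of_isLeftInvariantMetric [PseudoEMetricSpace G] [ChartedSpace E G]
    [LieGroup 𝓘(ℝ, E) ∞ G] [Bundle.RiemannianBundle (fun x : G ↦ TangentSpace 𝓘(ℝ, E) x)]
    [IsRiemannianManifold 𝓘(ℝ, E) G] (hG : IsLeftInvariantMetric E G) :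
    IsIsometricSMul G G := by
  refine ⟨fun g x y ↦ ?_⟩
  rw [IsRiemannianManifold.out (I := 𝓘(ℝ, E)), IsRiemannianManifold.out (I := 𝓘(ℝ, E))]
  refine le_antisymm (riemannianEDist_mul_left_le hG g x y) ?_
  simpa using riemannianEDist_mul_left_le hG g⁻¹ (g * x) (g * y)

/-- A Riemannian distance is a length distance: any decomposition of an upper bound for the
distance between two points is realized by an intermediate point. -/
theorem exists_dist_lt_dist_lt_of_isRiemannianManifold {M : Type*} [PseudoMetricSpace M]
    [ChartedSpace E M] [Bundle.RiemannianBundle (fun x : M ↦ TangentSpace 𝓘(ℝ, E) x)]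
    [IsRiemannianManifold 𝓘(ℝ, E) M] {x y : M} {r s : ℝ} (hr : 0 < r) (hs : 0 < s)
    (h : dist x y < r + s) : ∃ z, dist x z < r ∧ dist z y < s := by
  have h' : riemannianEDist 𝓘(ℝ, E) x y < ENNReal.ofReal (r + s) := by
    rw [← IsRiemannianManifold.out (I := 𝓘(ℝ, E)), edist_dist]
    exact (ENNReal.ofReal_lt_ofReal_iff (by positivity)).2 h
  obtain ⟨γ, h0, h1, hγ, hlen⟩ := exists_lt_of_riemannianEDist_lt h'
  have hcont : ContinuousOn γ (Icc 0 1) := hγ.continuousOn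
  have hsum : ∀ t ∈ Icc (0 : ℝ) 1, dist x (γ t) + dist (γ t) y < r + s := by
    intro t ht
    have e1 : edist x (γ t) ≤ pathELength 𝓘(ℝ, E) γ 0 t := by
      rw [IsRiemannianManifold.out (I := 𝓘(ℝ, E))]
      exact riemannianEDist_le_pathELength (hγ.mono (Icc_subset_Icc le_rfl ht.2)) h0 rfl ht.1
    have e2 : edist (γ t) y ≤ pathELength 𝓘(ℝ, E) γ t 1 := by
      rw [IsRiemannianManifold.out (I := 𝓘(ℝ, E))]
      exact riemannianEDist_le_pathELength (hγ.mono (Icc_subset_Icc ht.1 le_rfl)) rfl h1 ht.2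
    have e3 : edist x (γ t) + edist (γ t) y < ENNReal.ofReal (r + s) :=
      ((add_le_add e1 e2).trans_eq (pathELength_add ht.1 ht.2)).trans_lt hlen
    rw [edist_dist, edist_dist, ← ENNReal.ofReal_add dist_nonneg dist_nonneg] at e3
    exact (ENNReal.ofReal_lt_ofReal_iff (by positivity)).1 e3
  have hpre : IsPreconnected (γ '' Icc 0 1) := isPreconnected_Icc.image γ hcont
  -- The two open conditions cover the connected curve, since the two distances add up to less than
  -- `r + s` along it, and each holds at an endpoint. Hence they hold together somewhere.
  obtain ⟨z, -, hz1, hz2⟩ := hpre {z | dist x z < r} {z | dist z y < s}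
    (isOpen_lt (by fun_prop) (by fun_prop)) (isOpen_lt (by fun_prop) (by fun_prop))
    (by
      rintro _ ⟨t, ht, rfl⟩
      by_contra hcon
      simp only [mem_union, mem_ofPred_eq, not_or, not_lt] at hcon
      linarith [hsum t ht])
    ⟨x, ⟨0, by simp, h0⟩, by simpa using hr⟩ ⟨y, ⟨1, by simp, h1⟩, by simpa using hs⟩
  exact ⟨z, hz1, hz2⟩

/-- A `C²` function of two variables vanishing on both coordinate axes is locally bounded by a
multiple of the product of the norms of the variables. -/
theorem ContDiffAt.exists_norm_le_mul_of_vanishing {X Y Z : Type*} [NormedAddCommGroup X]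
    [NormedSpace ℝ X] [NormedAddCommGroup Y] [NormedSpace ℝ Y] [NormedAddCommGroup Z]
    [NormedSpace ℝ Z] {f : X × Y → Z} {a : X} {b : Y} (hf : ContDiffAt ℝ 2 f (a, b))
    (ha : ∀ᶠ y in 𝓝 b, f (a, y) = 0) (hb : ∀ᶠ x in 𝓝 a, f (x, b) = 0) :
    ∃ C : ℝ≥0, ∀ᶠ p in 𝓝 (a, b), ‖f p‖ ≤ C * ‖p.1 - a‖ * ‖p.2 - b‖ := by
  have hf' : ContDiffAt ℝ 1 (fderiv ℝ f) (a, b) := hf.fderiv_right (by norm_num)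
  obtain ⟨K, t, ht, hK⟩ := hf'.exists_lipschitzOnWith
  have hd : ∀ᶠ p in 𝓝 (a, b), DifferentiableAt ℝ f p :=
    (hf.eventually (by simp)).mono fun p hp ↦ hp.differentiableAt (by simp)
  have hb' : ∀ᶠ x in 𝓝 a, ∀ᶠ x' in 𝓝 x, f (x', b) = 0 := eventually_eventually_nhds.2 hb
  have hall : ∀ᶠ p in 𝓝 (a, b), p ∈ t ∧ DifferentiableAt ℝ f p :=
    (show ∀ᶠ p in 𝓝 (a, b), p ∈ t from ht).and hd
  obtain ⟨ε, hε, hball⟩ := Metric.eventually_nhds_iff_ball.1 hall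
  obtain ⟨ε₁, hε₁, hball₁⟩ := Metric.eventually_nhds_iff_ball.1 hb'
  obtain ⟨ε₂, hε₂, hball₂⟩ := Metric.eventually_nhds_iff_ball.1 ha
  refine ⟨K, Metric.eventually_nhds_iff_ball.2 ⟨min ε (min ε₁ ε₂), by positivity, ?_⟩⟩
  rintro ⟨x, y⟩ hxy
  rw [← ball_prod_same] at hxy hball
  obtain ⟨hx, hy⟩ := hxy
  have hx' : x ∈ Metric.ball a (min ε ε₁) :=
    Metric.ball_subset_ball (by simp) hx
  have hyε : y ∈ Metric.ball b ε := Metric.ball_subset_ball (by simp) hy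
  have hy2 : y ∈ Metric.ball b ε₂ := Metric.ball_subset_ball (by simp) hy
  -- The x-derivative of `f` vanishes on the axis y = b, so the Lipschitz bound for `fderiv` makes
  -- it at most K‖y - b‖. The mean value inequality along x, starting from f (a, y) = 0, gives the
  -- second factor.
  have key := (convex_ball a (min ε ε₁)).norm_image_sub_le_of_norm_hasFDerivWithin_le
    (f := fun x ↦ f (x, y)) (C := K * ‖y - b‖)
    (f' := fun x ↦ (fderiv ℝ f (x, y)).comp (ContinuousLinearMap.inl ℝ X Y))
    (fun x hx ↦ by
      have hxε : x ∈ Metric.ball a ε := Metric.ball_subset_ball (by simp) hx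
      have h1 := (hball (x, y) ⟨hxε, hyε⟩).2.hasFDerivAt
      exact (h1.comp x (hasFDerivAt_prodMk_left x y)).hasFDerivWithinAt)
    (fun x hx ↦ by
      have hxε : x ∈ Metric.ball a ε := Metric.ball_subset_ball (by simp) hx
      have hx1 : x ∈ Metric.ball a ε₁ := Metric.ball_subset_ball (by simp) hx
      have hxb := hball (x, b) ⟨hxε, Metric.mem_ball_self hε⟩
      have hz : (fderiv ℝ f (x, b)).comp (ContinuousLinearMap.inl ℝ X Y) = 0 := by
        have h1 : HasFDerivAt (fun x ↦ f (x, b)) _ x :=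
          hxb.2.hasFDerivAt.comp x (hasFDerivAt_prodMk_left x b)
        have h2 : HasFDerivAt (fun x ↦ f (x, b)) (0 : X →L[ℝ] Z) x :=
          (hasFDerivAt_const (0 : Z) x).congr_of_eventuallyEq (hball₁ x hx1)
        exact h1.unique h2
      have h3 : (fderiv ℝ f (x, y)).comp (ContinuousLinearMap.inl ℝ X Y) =
          (fderiv ℝ f (x, y) - fderiv ℝ f (x, b)).comp (ContinuousLinearMap.inl ℝ X Y) := by
        rw [ContinuousLinearMap.sub_comp, hz, sub_zero]
      rw [h3]
      refine (ContinuousLinearMap.opNorm_comp_le _ _).trans ?_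
      have h4 := hK.norm_sub_le (hball (x, y) ⟨hxε, hyε⟩).1 hxb.1
      have h5 : ‖((x, y) : X × Y) - (x, b)‖ = ‖y - b‖ := by simp [Prod.norm_def]
      rw [h5] at h4
      have h6 := ContinuousLinearMap.norm_inl_le_one ℝ X Y
      calc _ ≤ (K * ‖y - b‖) * 1 := by gcongr
        _ = _ := mul_one _)
    (Metric.mem_ball_self (by positivity)) hx'
  rw [hball₂ y hy2, sub_zero] at key
  calc ‖f (x, y)‖ ≤ K * ‖y - b‖ * ‖x - a‖ := key
    _ = K * ‖x - a‖ * ‖y - b‖ := by ring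

/-- In a chart around the identity, the multiplication of a Lie group is the addition up to an
error bounded by the product of the norms. -/
theorem exists_norm_extChartAt_mul_sub_le [TopologicalSpace G] [ChartedSpace E G]
    [LieGroup 𝓘(ℝ, E) ∞ G] :
    ∃ ψ : G → E, ContinuousAt ψ 1 ∧ (∀ x, ψ x = extChartAt 𝓘(ℝ, E) (1 : G) x - extChartAt 𝓘(ℝ, E) (1 : G) 1) ∧
      ∃ C : ℝ≥0, ∀ᶠ p in 𝓝 ((1, 1) : G × G),
        ‖ψ (p.1 * p.2) - ψ p.1 - ψ p.2‖ ≤ C * ‖ψ p.1‖ * ‖ψ p.2‖ := by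
  set χ := extChartAt 𝓘(ℝ, E) (1 : G) with hχ
  have hχc : ContinuousAt χ 1 := continuousAt_extChartAt 1
  refine ⟨fun x ↦ χ x - χ 1, hχc.sub continuousAt_const, fun _ ↦ rfl, ?_⟩
  have hsymm : ContMDiffAt 𝓘(ℝ, E) 𝓘(ℝ, E) ∞ χ.symm (χ 1) :=
    (contMDiffOn_extChartAt_symm (I := 𝓘(ℝ, E)) (n := ∞) (1 : G)).contMDiffAt
      (extChartAt_target_mem_nhds (I := 𝓘(ℝ, E)) (1 : G))
  have h1 : χ.symm (χ 1) = 1 := extChartAt_to_inv (I := 𝓘(ℝ, E)) (1 : G)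
  -- The deviation of multiplication from addition; adding χ 1 makes it vanish on both axes through
  -- (χ 1, χ 1).
  let f : E × E → E := fun p ↦ χ (χ.symm p.1 * χ.symm p.2) - p.1 - p.2 + χ 1
  have hf : ContDiffAt ℝ ∞ f (χ 1, χ 1) := by
    have hm : ContMDiffAt (𝓘(ℝ, E × E)) 𝓘(ℝ, E) ∞
        (fun p : E × E ↦ χ.symm p.1 * χ.symm p.2) (χ 1, χ 1) := by
      refine ContMDiffAt.mul ?_ ?_
      · exact ContMDiffAt.comp (χ 1, χ 1) (g := χ.symm) hsymm contDiffAt_fst.contMDiffAt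
      · exact ContMDiffAt.comp (χ 1, χ 1) (g := χ.symm) hsymm contDiffAt_snd.contMDiffAt
    have hχs : ContMDiffAt 𝓘(ℝ, E) 𝓘(ℝ, E) ∞ χ 1 :=
      contMDiffAt_extChartAt (x := (1 : G))
    have hcomp : ContMDiffAt (𝓘(ℝ, E × E)) 𝓘(ℝ, E) ∞
        (fun p : E × E ↦ χ (χ.symm p.1 * χ.symm p.2)) (χ 1, χ 1) :=
      ContMDiffAt.comp (χ 1, χ 1) (g := χ) (by simpa [h1] using hχs) hm
    exact ((hcomp.contDiffAt.sub contDiffAt_fst).sub contDiffAt_snd).add contDiffAt_const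
  have htgt : ∀ᶠ y in 𝓝 (χ 1), y ∈ χ.target := extChartAt_target_mem_nhds (I := 𝓘(ℝ, E)) (1 : G)
  obtain ⟨C, hC⟩ := ContDiffAt.exists_norm_le_mul_of_vanishing (contDiffAt_infty.1 hf 2)
    (htgt.mono fun y hy ↦ by simp [f, h1, χ.right_inv hy])
    (htgt.mono fun y hy ↦ by simp [f, h1, χ.right_inv hy])
  refine ⟨C, ?_⟩
  have hsrc : ∀ᶠ x in 𝓝 (1 : G), x ∈ χ.source := extChartAt_source_mem_nhds (I := 𝓘(ℝ, E)) (1 : G)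
  have ht : Tendsto (fun p : G × G ↦ (χ p.1, χ p.2)) (𝓝 (1, 1)) (𝓝 (χ 1, χ 1)) := by
    rw [nhds_prod_eq, nhds_prod_eq]
    exact Tendsto.prodMap hχc hχc
  filter_upwards [ht.eventually hC, hsrc.prod_nhds hsrc] with p hp hps
  simp only [f, χ.left_inv hps.1, χ.left_inv hps.2] at hp
  convert hp using 2
  abel

end RiemannianInterface

/-! ### Gleason metrics and length groups -/

section LeftInvariantMetric

variable {G : Type*} [Group G] [PseudoMetricSpace G]

theorem dist_eq_dist_one_inv_mul [IsIsometricSMul G G] (x y : G) : dist x y = dist 1 (x⁻¹ * y) := by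
  rw [← dist_mul_left x⁻¹ x y, inv_mul_cancel]

theorem dist_one_mul_le [IsIsometricSMul G G] (x y : G) : dist 1 (x * y) ≤ dist 1 x + dist 1 y := by
  refine (dist_triangle 1 x (x * y)).trans_eq ?_
  rw [dist_eq_dist_one_inv_mul x (x * y), inv_mul_cancel_left]

theorem dist_one_inv [IsIsometricSMul G G] (x : G) : dist 1 x⁻¹ = dist 1 x := by
  rw [dist_comm 1 x, dist_eq_dist_one_inv_mul x 1, mul_one]

theorem dist_one_pow_le [IsIsometricSMul G G] (x : G) (n : ℕ) : dist 1 (x ^ n) ≤ n * dist 1 x := by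
  induction n with
  | zero => simp
  | succ n ih =>
    rw [pow_succ]
    refine (dist_one_mul_le _ _).trans ?_
    push_cast
    linarith

/-- Gleason's conditions on a left-invariant metric on a group: small elements have powers escaping
at linear speed, and commutators of small elements are quadratically small. -/
structure IsGleasonMetric (G : Type*) [Group G] [PseudoMetricSpace G] (C δ : ℝ) : Prop where
  one_le : 1 ≤ C
  pos : 0 < δ
  escape : ∀ (g : G) (n : ℕ), n * dist 1 g ≤ δ → n * dist 1 g ≤ C * dist 1 (g ^ n)
  commutator : ∀ x y : G, dist 1 x ≤ δ → dist 1 y ≤ δ →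
    dist (x * y) (y * x) ≤ C * dist 1 x * dist 1 y

/-- If all powers up to exponent `M` of an element are small, then the element is `M` times
smaller. -/
theorem IsGleasonMetric.mul_dist_one_le {C δ : ℝ} (h : IsGleasonMetric G C δ) {η : ℝ}
    (hη : (C + 1) * η ≤ δ) (w : G) (M : ℕ) (hw : ∀ k ≤ M, dist 1 (w ^ k) ≤ η) :
    M * dist 1 w ≤ C * η := by
  have hC := h.one_le
  induction M with
  | zero =>
    have := hw 0 le_rfl
    simp only [pow_zero, dist_self] at this
    simpa using mul_nonneg (by linarith) this
  | succ M ih =>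
    have h1 := ih fun k hk ↦ hw k (hk.trans (Nat.le_succ M))
    have h2 : dist 1 w ≤ η := by simpa using hw 1 (by simp)
    -- Bootstrap: the bounds for exponents M and 1 give (M + 1)|w| ≤ (C + 1)η ≤ δ, which is the
    -- hypothesis of escape.
    have h3 := h.escape w (M + 1) (by push_cast; linarith)
    exact h3.trans (mul_le_mul_of_nonneg_left (hw _ le_rfl) (by linarith))

/-- By left invariance |x⁻¹ux| = d(x, ux), and the path through xu costs |u| plus the commutator
bound. -/
theorem IsGleasonMetric.dist_one_conj_le [IsIsometricSMul G G] {C δ : ℝ} (h : IsGleasonMetric G C δ) {x u : G}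
    (hx : dist 1 x ≤ δ) (hu : dist 1 u ≤ δ) :
    dist 1 (x⁻¹ * u * x) ≤ (1 + C * dist 1 x) * dist 1 u := by
  have h1 : dist 1 (x⁻¹ * u * x) = dist x (u * x) := by
    rw [dist_eq_dist_one_inv_mul x, mul_assoc]
  have h2 : dist x (x * u) = dist 1 u := by
    rw [dist_eq_dist_one_inv_mul x, inv_mul_cancel_left]
  rw [h1]
  linarith [dist_triangle x (x * u) (u * x), h.commutator x u hx hu]

/-- In a length group, every element is a product of an element of smaller norm and a
small element. -/
def IsLengthGroup (G : Type*) [Group G] [PseudoMetricSpace G] : Prop :=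
  ∀ (g : G) (r s : ℝ), 0 < r → 0 < s → dist 1 g < r + s →
    ∃ h k : G, g = h * k ∧ dist 1 h < r ∧ dist 1 k < s

/-- In a length group, a linear bound near the identity for a subadditive function holds
everywhere. -/
theorem IsLengthGroup.le_mul_of_subadditive (hl : IsLengthGroup G) {f : G → ℝ}
    (hf : ∀ x y, f (x * y) ≤ f x + f y) {C ε : ℝ} (hC : 0 ≤ C) (hε : 0 < ε)
    (hloc : ∀ x, dist 1 x < ε → f x ≤ C * dist 1 x) (x : G) : f x ≤ C * dist 1 x := by
  have key : ∀ (n : ℕ) (R : ℝ), 0 < R → R ≤ ε → ∀ x : G, dist 1 x < (n + 1) * R →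
      f x ≤ (n + 1) * (C * R) := by
    intro n R hR hRε
    induction n with
    | zero =>
      intro x hx
      simp only [CharP.cast_eq_zero, zero_add, one_mul] at hx ⊢
      exact (hloc x (hx.trans_le hRε)).trans (by gcongr)
    | succ n ih =>
      intro x hx
      obtain ⟨h, k, rfl, hh, hk⟩ := hl x ((n + 1) * R) R (by positivity) hR
        (by push_cast at hx; linarith)
      have h1 := ih h hh
      have h2 := (hloc k (hk.trans_le hRε)).trans (mul_le_mul_of_nonneg_left hk.le hC)
      push_cast
      linarith [hf h k]
  have key2 : ∀ R, dist 1 x < R → f x ≤ C * R := by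
    intro R hR
    have hR0 : 0 < R := dist_nonneg.trans_lt hR
    obtain ⟨n, hn⟩ := exists_nat_gt (R / ε)
    have hn' : R / ε < n + 1 := by linarith
    have := key n (R / (n + 1)) (by positivity)
      (by rw [div_le_iff₀ (by positivity)]; rw [div_lt_iff₀ hε] at hn'; linarith) x
      (by rwa [mul_div_cancel₀ _ (by positivity)])
    calc f x ≤ _ := this
      _ = C * R := by field_simp
  refine le_of_forall_pos_le_add fun ε' hε' ↦ ?_
  -- Dividing by C + 1 instead of C also covers C = 0.
  have h1 := key2 (dist 1 x + ε' / (C + 1)) (by linarith [div_pos hε' (by linarith : 0 < C + 1)])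
  refine h1.trans ?_
  have h2 : C * (ε' / (C + 1)) ≤ ε' := by
    rw [mul_div_assoc', div_le_iff₀ (by linarith)]
    nlinarith
  linarith

end LeftInvariantMetric

/-- A left-invariant metric controlled by a chart in which the multiplication is approximately the
addition is a Gleason metric. -/
theorem exists_isGleasonMetric {G E : Type*} [Group G] [MetricSpace G]
    [IsIsometricSMul G G] [NormedAddCommGroup E] [NormedSpace ℝ E] {ψ : G → E}
    (hψ : ContinuousAt ψ 1) (hψ1 : ψ 1 = 0) {C₀ C₁ : ℝ≥0}
    (hmul : ∀ᶠ p in 𝓝 ((1, 1) : G × G),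
        ‖ψ (p.1 * p.2) - ψ p.1 - ψ p.2‖ ≤ C₀ * ‖ψ p.1‖ * ‖ψ p.2‖)
    (hdist : ∀ᶠ x in 𝓝 (1 : G), dist 1 x ≤ C₁ * ‖ψ x‖) :
    ∃ C δ : ℝ, IsGleasonMetric G C δ := by
  -- Chosen so that C₀ε ≤ 1/2: multiplying by g an element whose ψ-norm is at most ε then makes an
  -- error of at most half of ‖ψ g‖.
  set ε : ℝ := 1 / (2 * (C₀ + 1)) with hε
  have hε0 : 0 < ε := by positivity
  have hC₀ε : C₀ * ε ≤ 1 / 2 := by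
    rw [hε, mul_one_div, div_le_div_iff₀ (by positivity) (by norm_num)]
    linarith [C₀.coe_nonneg]
  have hsmall : ∀ᶠ x in 𝓝 (1 : G), ‖ψ x‖ ≤ ε := by
    have h1 : Tendsto (fun x ↦ ‖ψ x‖) (𝓝 1) (𝓝 0) := by simpa [hψ1] using hψ.norm.tendsto
    exact (h1.eventually (gt_mem_nhds hε0)).mono fun x hx ↦ le_of_lt hx
  obtain ⟨ρ₁, hρ₁, hb₁⟩ := Metric.eventually_nhds_iff_ball.1 hmul
  obtain ⟨ρ₂, hρ₂, hb₂⟩ := Metric.eventually_nhds_iff_ball.1 (hdist.and hsmall)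
  obtain ⟨ρ, hρ, hρ1, hρ2⟩ : ∃ ρ > 0, ρ ≤ ρ₁ ∧ ρ ≤ ρ₂ := ⟨min ρ₁ ρ₂, by positivity, by simp, by simp⟩
  have hmul' : ∀ x y : G, dist 1 x < ρ → dist 1 y < ρ →
      ‖ψ (x * y) - ψ x - ψ y‖ ≤ C₀ * ‖ψ x‖ * ‖ψ y‖ := by
    intro x y hx hy
    refine hb₁ (x, y) ?_
    rw [← ball_prod_same]
    exact ⟨by rw [Metric.mem_ball, dist_comm]; linarith,
      by rw [Metric.mem_ball, dist_comm]; linarith⟩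
  have hd : ∀ x : G, dist 1 x < ρ → dist 1 x ≤ C₁ * ‖ψ x‖ := fun x hx ↦
    (hb₂ x (by rw [Metric.mem_ball, dist_comm]; linarith)).1
  have hs : ∀ x : G, dist 1 x < ρ → ‖ψ x‖ ≤ ε := fun x hx ↦
    (hb₂ x (by rw [Metric.mem_ball, dist_comm]; linarith)).2
  have hpow : ∀ (g : G) (n : ℕ), n * dist 1 g < ρ → dist 1 g < ρ →
      ∀ k ≤ n, ‖ψ (g ^ k) - (k : ℝ) • ψ g‖ ≤ k / 2 * ‖ψ g‖ := by
    intro g n hn hg k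
    induction k with
    | zero => intro _; simp [hψ1]
    | succ k ih =>
      intro hk
      have h1 := ih (by omega)
      have hgk : dist 1 (g ^ k) < ρ := by
        refine (dist_one_pow_le g k).trans_lt (lt_of_le_of_lt ?_ hn)
        have : (k : ℝ) ≤ n := by exact_mod_cast (by omega : k ≤ n)
        gcongr
      have h2 := hmul' (g ^ k) g hgk hg
      have h3 : C₀ * ‖ψ (g ^ k)‖ * ‖ψ g‖ ≤ 1 / 2 * ‖ψ g‖ := by
        gcongr
        exact (mul_le_mul_of_nonneg_left (hs _ hgk) C₀.coe_nonneg).trans hC₀ε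
      have h4 : ψ (g ^ (k + 1)) - ((k + 1 : ℕ) : ℝ) • ψ g =
          (ψ (g ^ k * g) - ψ (g ^ k) - ψ g) + (ψ (g ^ k) - (k : ℝ) • ψ g) := by
        rw [pow_succ]
        push_cast
        rw [add_smul, one_smul]
        abel
      rw [h4]
      refine (norm_add_le _ _).trans ?_
      push_cast
      linarith
  have hlow : ∀ (g : G) (n : ℕ), n * dist 1 g < ρ → dist 1 g < ρ →
      n * ‖ψ g‖ ≤ 2 * ‖ψ (g ^ n)‖ := by
    intro g n hn hg
    have h1 := hpow g n hn hg n le_rfl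
    have h2 : ‖(n : ℝ) • ψ g‖ = n * ‖ψ g‖ := by simp [norm_smul]
    have h3 := norm_sub_norm_le ((n : ℝ) • ψ g) (ψ (g ^ n))
    rw [norm_sub_rev] at h3
    linarith
  set C₂ : ℝ := 8 * ε / ρ with hC₂
  have hC₂0 : 0 < C₂ := by positivity
  -- `hdist` bounds the distance by ψ only. The reverse bound comes from powers: for n about
  -- ρ/(2|g|) the power g^n is still in the good ball, so n‖ψ g‖ ≤ 2‖ψ (g^n)‖ ≤ 2ε.
  have hup : ∀ g : G, dist 1 g ≤ ρ / 2 → ‖ψ g‖ ≤ C₂ * dist 1 g := by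
    intro g hg
    rcases (dist_nonneg (x := (1 : G)) (y := g)).eq_or_lt with h0 | h0
    · rw [eq_comm, dist_eq_zero] at h0
      simp [← h0, hψ1]
    · have hq : 1 ≤ ρ / (2 * dist 1 g) := by rw [le_div_iff₀ (by positivity)]; linarith
      set n := ⌊ρ / (2 * dist 1 g)⌋₊ with hn
      have hn1 : 1 ≤ n := Nat.le_floor (by simpa using hq)
      have hn2 : (n : ℝ) ≤ ρ / (2 * dist 1 g) := Nat.floor_le (by positivity)
      have hn3 : ρ / (2 * dist 1 g) < n + 1 := Nat.lt_floor_add_one _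
      have hn1' : (1 : ℝ) ≤ n := by exact_mod_cast hn1
      rw [le_div_iff₀ (by positivity)] at hn2
      rw [div_lt_iff₀ (by positivity)] at hn3
      have h1 := hlow g n (by nlinarith) (by linarith)
      have h2 : ‖ψ (g ^ n)‖ ≤ ε := hs _ (by linarith [dist_one_pow_le g n])
      rw [hC₂, div_mul_eq_mul_div, le_div_iff₀ hρ]
      have h3 : n * ‖ψ g‖ ≤ 2 * ε := by linarith
      have h4 : ρ ≤ 4 * n * dist 1 g := by nlinarith
      calc ‖ψ g‖ * ρ ≤ ‖ψ g‖ * (4 * n * dist 1 g) := by gcongr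
        _ = 4 * (n * ‖ψ g‖) * dist 1 g := by ring
        _ ≤ 4 * (2 * ε) * dist 1 g := by gcongr
        _ = 8 * ε * dist 1 g := by ring
  -- The two products are the escape and commutator constants. The radius ρ/8 keeps x * y, y * x and
  -- their quotient z within ρ/2.
  refine ⟨max 1 (max (2 * C₁ * C₂) (4 * C₀ * C₁ * C₂ * C₂)), ρ / 8, by simp, by positivity, ?_, ?_⟩
  · intro g n hn
    rcases Nat.eq_zero_or_pos n with rfl | hn0
    · simp
    have hn1 : (1 : ℝ) ≤ n := by exact_mod_cast hn0
    have hg : dist 1 g ≤ ρ / 8 := by nlinarith [dist_nonneg (x := (1 : G)) (y := g)]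
    have h1 := hlow g n (by linarith) (by linarith)
    have h2 := hd g (by linarith)
    have h3 := hup (g ^ n) (by linarith [dist_one_pow_le g n])
    calc n * dist 1 g ≤ n * (C₁ * ‖ψ g‖) := by gcongr
      _ = C₁ * (n * ‖ψ g‖) := by ring
      _ ≤ C₁ * (2 * (C₂ * dist 1 (g ^ n))) :=
        mul_le_mul_of_nonneg_left (by linarith) C₁.coe_nonneg
      _ = (2 * C₁ * C₂) * dist 1 (g ^ n) := by ring
      _ ≤ _ := by gcongr; simp
  · intro x y hx hy
    set z := (x * y)⁻¹ * (y * x) with hz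
    have hxy : x * y * z = y * x := by rw [hz, mul_inv_cancel_left]
    have hxyn : dist 1 (x * y) ≤ ρ / 4 := (dist_one_mul_le _ _).trans (by linarith)
    have hyxn : dist 1 (y * x) ≤ ρ / 4 := (dist_one_mul_le _ _).trans (by linarith)
    have hzn : dist 1 z ≤ ρ / 2 :=
      (dist_one_mul_le _ _).trans (by rw [dist_one_inv]; linarith)
    have h1 := hmul' x y (by linarith) (by linarith)
    have h2 := hmul' y x (by linarith) (by linarith)
    have h3 := hmul' (x * y) z (by linarith) (by linarith)
    have h4 : C₀ * ‖ψ (x * y)‖ * ‖ψ z‖ ≤ 1 / 2 * ‖ψ z‖ := by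
      gcongr
      exact (mul_le_mul_of_nonneg_left (hs _ (by linarith)) C₀.coe_nonneg).trans hC₀ε
    rw [hxy] at h3
    -- ψ z is a combination of three multiplication errors. That of (x * y) * z is at most ‖ψ z‖/2
    -- and is absorbed on the left.
    have h5 : ‖ψ z‖ ≤ 2 * (2 * (C₀ * ‖ψ x‖ * ‖ψ y‖)) := by
      have e : ψ z = (ψ (y * x) - ψ y - ψ x) - (ψ (x * y) - ψ x - ψ y) -
          (ψ (y * x) - ψ (x * y) - ψ z) := by abel
      have e1 := norm_sub_le ((ψ (y * x) - ψ y - ψ x) - (ψ (x * y) - ψ x - ψ y))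
        (ψ (y * x) - ψ (x * y) - ψ z)
      have e2 := norm_sub_le (ψ (y * x) - ψ y - ψ x) (ψ (x * y) - ψ x - ψ y)
      rw [← e] at e1
      linarith [mul_right_comm (C₀ : ℝ) ‖ψ x‖ ‖ψ y‖]
    rw [dist_eq_dist_one_inv_mul, ← hz]
    have hx' := hup x (by linarith)
    have hy' := hup y (by linarith)
    calc dist 1 z ≤ C₁ * ‖ψ z‖ := hd z (by linarith)
      _ ≤ C₁ * (2 * (2 * (C₀ * (C₂ * dist 1 x) * (C₂ * dist 1 y)))) := by
        gcongr
        exact h5.trans (by gcongr)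
      _ = (4 * C₀ * C₁ * C₂ * C₂) * dist 1 x * dist 1 y := by ring
      _ ≤ _ := by gcongr; simp

/-- A left-invariant Riemannian metric on a Lie group is a Gleason metric. -/
theorem exists_isGleasonMetric_of_isLeftInvariantMetric
    {E : Type*} [NormedAddCommGroup E] [NormedSpace ℝ E]
    {G : Type*} [Group G] [MetricSpace G] [ChartedSpace E G] [LieGroup 𝓘(ℝ, E) ∞ G]
    [Bundle.RiemannianBundle (fun x : G ↦ TangentSpace 𝓘(ℝ, E) x)]
    [IsContMDiffRiemannianBundle 𝓘(ℝ, E) ∞ E (fun x : G ↦ TangentSpace 𝓘(ℝ, E) x)]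
    [IsRiemannianManifold 𝓘(ℝ, E) G] (hG : IsLeftInvariantMetric E G) :
    ∃ C δ : ℝ, IsGleasonMetric G C δ := by
  have := isIsometricSMul_of_isLeftInvariantMetric hG
  obtain ⟨ψ, hψ, hψe, C₀, hC₀⟩ := exists_norm_extChartAt_mul_sub_le (E := E) (G := G)
  have : IsManifold 𝓘(ℝ, E) 1 G := IsManifold.of_le (n := ∞) (by simp)
  have : IsContinuousRiemannianBundle E (fun x : G ↦ TangentSpace 𝓘(ℝ, E) x) := by
    have := IsContMDiffRiemannianBundle.exists_contMDiff (IB := 𝓘(ℝ, E)) (n := ∞) (F := E)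
      (E := (fun x : G ↦ TangentSpace 𝓘(ℝ, E) x))
    obtain ⟨g, hg, hg'⟩ := this
    exact ⟨⟨g, hg.continuous, hg'⟩⟩
  obtain ⟨C₁, -, hC₁⟩ := eventually_riemannianEDist_le_edist_extChartAt 𝓘(ℝ, E) (1 : G)
  refine exists_isGleasonMetric (C₁ := C₁) hψ (by simp [hψe]) hC₀ ?_
  filter_upwards [hC₁] with x hx
  rw [← IsRiemannianManifold.out (I := 𝓘(ℝ, E)), edist_dist, edist_dist,
    ← ENNReal.ofReal_coe_nnreal, ← ENNReal.ofReal_mul (by simp),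
    ENNReal.ofReal_le_ofReal_iff (by positivity)] at hx
  rwa [hψe, ← dist_eq_norm, dist_comm (extChartAt 𝓘(ℝ, E) (1 : G) x)]

/-- A left-invariant Riemannian metric makes a Lie group into a length group. -/
theorem isLengthGroup_of_isLeftInvariantMetric
    {E : Type*} [NormedAddCommGroup E] [NormedSpace ℝ E]
    {G : Type*} [Group G] [MetricSpace G] [ChartedSpace E G] [LieGroup 𝓘(ℝ, E) ∞ G]
    [Bundle.RiemannianBundle (fun x : G ↦ TangentSpace 𝓘(ℝ, E) x)]
    [IsRiemannianManifold 𝓘(ℝ, E) G] (hG : IsLeftInvariantMetric E G) :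
    IsLengthGroup G := by
  have := isIsometricSMul_of_isLeftInvariantMetric hG
  intro g r s hr hs h
  obtain ⟨z, hz1, hz2⟩ := exists_dist_lt_dist_lt_of_isRiemannianManifold (E := E) hr hs h
  exact ⟨z, z⁻¹ * g, by simp, hz1, by rwa [← dist_eq_dist_one_inv_mul]⟩

/-! ### One-parameter subgroups of an abelian group and the exponential map -/

/-- Lipschitz one-parameter subgroups of a metric group. -/
@[ext]
structure OneParameterSubgroup (A : Type*) [Group A] [PseudoMetricSpace A] where
  /-- The underlying map. -/
  toFun : ℝ → A
  map_add' : ∀ s t, toFun (s + t) = toFun s * toFun t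
  lipschitz' : ∃ K : ℝ, 0 ≤ K ∧ ∀ t, dist 1 (toFun t) ≤ K * |t|

set_option linter.unusedSectionVars false

namespace OneParameterSubgroup

section Algebra

variable {A : Type*} [CommGroup A] [PseudoMetricSpace A] [IsIsometricSMul A A]

instance : Zero (OneParameterSubgroup A) := ⟨⟨fun _ ↦ 1, by simp, 0, by simp⟩⟩

instance : Add (OneParameterSubgroup A) := ⟨fun φ ψ ↦ ⟨fun t ↦ φ.toFun t * ψ.toFun t,
  fun s t ↦ by rw [φ.map_add', ψ.map_add', mul_mul_mul_comm], by
    obtain ⟨K, hK, h⟩ := φ.lipschitz'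
    obtain ⟨L, hL, h'⟩ := ψ.lipschitz'
    exact ⟨K + L, by positivity, fun t ↦ (dist_one_mul_le _ _).trans (by linarith [h t, h' t])⟩⟩⟩

instance : Neg (OneParameterSubgroup A) := ⟨fun φ ↦ ⟨fun t ↦ (φ.toFun t)⁻¹,
  fun s t ↦ by rw [φ.map_add', mul_inv], by
    obtain ⟨K, hK, h⟩ := φ.lipschitz'
    exact ⟨K, hK, fun t ↦ by rw [dist_one_inv]; exact h t⟩⟩⟩

instance : SMul ℝ (OneParameterSubgroup A) := ⟨fun c φ ↦ ⟨fun t ↦ φ.toFun (t * c),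
  fun s t ↦ by rw [add_mul, φ.map_add'], by
    obtain ⟨K, hK, h⟩ := φ.lipschitz'
    exact ⟨K * |c|, by positivity, fun t ↦ (h _).trans_eq (by rw [abs_mul]; ring)⟩⟩⟩

@[simp] theorem zero_apply (t : ℝ) : (0 : OneParameterSubgroup A).toFun t = 1 := rfl

@[simp] theorem add_apply (φ ψ : OneParameterSubgroup A) (t : ℝ) :
    (φ + ψ).toFun t = φ.toFun t * ψ.toFun t := rfl

@[simp] theorem neg_apply (φ : OneParameterSubgroup A) (t : ℝ) :
    (-φ).toFun t = (φ.toFun t)⁻¹ := rfl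

@[simp] theorem smul_apply (c : ℝ) (φ : OneParameterSubgroup A) (t : ℝ) :
    (c • φ).toFun t = φ.toFun (t * c) := rfl

theorem map_zero (φ : OneParameterSubgroup A) : φ.toFun 0 = 1 := by
  have := φ.map_add' 0 0
  simpa using this

theorem map_neg (φ : OneParameterSubgroup A) (t : ℝ) : φ.toFun (-t) = (φ.toFun t)⁻¹ := by
  rw [eq_inv_iff_mul_eq_one, ← φ.map_add', neg_add_cancel, φ.map_zero]

theorem map_nat_mul (φ : OneParameterSubgroup A) (n : ℕ) (t : ℝ) :
    φ.toFun (n * t) = φ.toFun t ^ n := by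
  induction n with
  | zero => simp [φ.map_zero]
  | succ n ih => rw [Nat.cast_succ, add_mul, one_mul, φ.map_add', ih, pow_succ]

instance : AddCommGroup (OneParameterSubgroup A) where
  add_assoc φ ψ χ := by ext t; simp [mul_assoc]
  zero_add φ := by ext t; simp
  add_zero φ := by ext t; simp
  add_comm φ ψ := by ext t; simp [mul_comm]
  neg_add_cancel φ := by ext t; simp
  nsmul := nsmulRec
  zsmul := zsmulRec

instance : Module ℝ (OneParameterSubgroup A) where
  one_smul φ := by ext t; simp
  mul_smul c d φ := by ext t; simp [mul_assoc]
  smul_zero c := by ext t; simp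
  smul_add c φ ψ := by ext t; simp
  add_smul c d φ := by ext t; simp [mul_add, φ.map_add']
  zero_smul φ := by ext t; simp [φ.map_zero]

end Algebra

variable {A : Type*} [CommGroup A] [MetricSpace A] [IsIsometricSMul A A]

/-- The speed of a one-parameter subgroup. -/
noncomputable def speed (φ : OneParameterSubgroup A) : ℝ :=
  sInf {K : ℝ | 0 ≤ K ∧ ∀ t, dist 1 (φ.toFun t) ≤ K * |t|}

theorem speed_le (φ : OneParameterSubgroup A) {K : ℝ} (hK : 0 ≤ K)
    (h : ∀ t, dist 1 (φ.toFun t) ≤ K * |t|) : φ.speed ≤ K :=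
  csInf_le ⟨0, fun _ h ↦ h.1⟩ ⟨hK, h⟩

theorem speed_nonneg (φ : OneParameterSubgroup A) : 0 ≤ φ.speed :=
  le_csInf φ.lipschitz' fun _ h ↦ h.1

theorem dist_one_le_speed (φ : OneParameterSubgroup A) (t : ℝ) :
    dist 1 (φ.toFun t) ≤ φ.speed * |t| := by
  rcases eq_or_ne t 0 with rfl | ht
  · simp [φ.map_zero]
  · have ht' : 0 < |t| := abs_pos.2 ht
    rw [← div_le_iff₀ ht']
    refine le_csInf φ.lipschitz' fun K hK ↦ ?_
    rw [div_le_iff₀ ht']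
    exact hK.2 t

/-- The speed plays the role of a norm on the Lie algebra. Completeness is never needed: limits are
taken pointwise in A by compactness. -/
noncomputable instance : NormedAddCommGroup (OneParameterSubgroup A) :=
  AddGroupNorm.toNormedAddCommGroup
    { toFun := speed
      map_zero' := le_antisymm (speed_le _ le_rfl (by simp)) (speed_nonneg _)
      add_le' := fun φ ψ ↦ speed_le _ (add_nonneg φ.speed_nonneg ψ.speed_nonneg) fun t ↦
        (dist_one_mul_le _ _).trans
          (by linarith [φ.dist_one_le_speed t, ψ.dist_one_le_speed t])
      neg' := fun φ ↦ by
        have : ∀ φ : OneParameterSubgroup A, (-φ).speed ≤ φ.speed := fun φ ↦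
          speed_le _ φ.speed_nonneg fun t ↦ by
            rw [neg_apply, dist_one_inv]
            exact φ.dist_one_le_speed t
        exact le_antisymm (this φ) (by simpa using this (-φ))
      eq_zero_of_map_eq_zero' := fun φ h ↦ by
        ext t
        have := φ.dist_one_le_speed t
        rw [h, zero_mul, dist_le_zero] at this
        exact this.symm }

theorem norm_eq_speed (φ : OneParameterSubgroup A) : ‖φ‖ = φ.speed := rfl

noncomputable instance : NormedSpace ℝ (OneParameterSubgroup A) where
  norm_smul_le c φ := by
    refine speed_le _ (by positivity) fun t ↦ (φ.dist_one_le_speed _).trans_eq ?_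
    rw [abs_mul, norm_eq_speed, Real.norm_eq_abs]
    ring

theorem dist_one_apply_le (φ : OneParameterSubgroup A) (t : ℝ) :
    dist 1 (φ.toFun t) ≤ ‖φ‖ * |t| := φ.dist_one_le_speed t

theorem norm_le (φ : OneParameterSubgroup A) {K : ℝ} (hK : 0 ≤ K)
    (h : ∀ t, dist 1 (φ.toFun t) ≤ K * |t|) : ‖φ‖ ≤ K := φ.speed_le hK h

theorem dist_one_apply_one_le (φ : OneParameterSubgroup A) : dist 1 (φ.toFun 1) ≤ ‖φ‖ := by
  simpa using φ.dist_one_apply_le 1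

/-- For a Gleason metric, the norm of a slow one-parameter subgroup is controlled by its value at
time one. -/
theorem norm_le_of_norm_le {C δ : ℝ} (h : IsGleasonMetric A C δ) (φ : OneParameterSubgroup A)
    (hφ : ‖φ‖ ≤ δ) : ‖φ‖ ≤ C * dist 1 (φ.toFun 1) := by
  have hC := h.one_le
  have hpos : ∀ t, 0 ≤ t → dist 1 (φ.toFun t) ≤ C * dist 1 (φ.toFun 1) * t := by
    intro t ht
    -- Sample at step s = 1/(n + 1): escape gives |φ s| ≤ C|φ 1|s. The time t is ⌊t/s⌋ such steps
    -- plus a remainder of length at most ‖φ‖s, which vanishes as n grows.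
    have key : ∀ n : ℕ, dist 1 (φ.toFun t) ≤
        C * dist 1 (φ.toFun 1) * t + ‖φ‖ * (1 / ((n : ℝ) + 1)) := by
      intro n
      have hn : (0 : ℝ) < (n + 1 : ℕ) := by positivity
      set s : ℝ := 1 / (n + 1 : ℕ) with hs
      have hs0 : 0 < s := by positivity
      have hns : ((n + 1 : ℕ) : ℝ) * s = 1 := by rw [hs]; field_simp
      have h1 : ((n + 1 : ℕ) : ℝ) * dist 1 (φ.toFun s) ≤ C * dist 1 (φ.toFun 1) := by
        have h2 := φ.dist_one_apply_le s
        rw [abs_of_pos hs0] at h2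
        have h3 : ((n + 1 : ℕ) : ℝ) * dist 1 (φ.toFun s) ≤ δ := by
          calc _ ≤ ((n + 1 : ℕ) : ℝ) * (‖φ‖ * s) := by gcongr
            _ = ‖φ‖ * (((n + 1 : ℕ) : ℝ) * s) := by ring
            _ ≤ δ := by rw [hns, mul_one]; exact hφ
        have h4 := h.escape _ _ h3
        rwa [← φ.map_nat_mul, hns] at h4
      set k := ⌊t / s⌋₊ with hk
      have hk1 : k * s ≤ t := by
        have := Nat.floor_le (div_nonneg ht hs0.le)
        rwa [le_div_iff₀ hs0] at this
      have hk2 : t < (k + 1) * s := by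
        have := Nat.lt_floor_add_one (t / s)
        rwa [div_lt_iff₀ hs0] at this
      have h5 : φ.toFun t = φ.toFun s ^ k * φ.toFun (t - k * s) := by
        rw [← φ.map_nat_mul, ← φ.map_add']; congr 1; ring
      have h6 := φ.dist_one_apply_le (t - k * s)
      rw [abs_of_nonneg (by linarith)] at h6
      have h7 : ‖φ‖ * (t - k * s) ≤ ‖φ‖ * s := by gcongr; linarith
      have h8 : k * dist 1 (φ.toFun s) ≤ C * dist 1 (φ.toFun 1) * t := by
        have e : k * dist 1 (φ.toFun s) = (k * s) * (((n + 1 : ℕ) : ℝ) * dist 1 (φ.toFun s)) := by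
          calc _ = k * (((n + 1 : ℕ) : ℝ) * s) * dist 1 (φ.toFun s) := by rw [hns, mul_one]
            _ = _ := by ring
        rw [e, mul_comm _ t]
        gcongr
      rw [h5]
      have h9 := dist_one_pow_le (φ.toFun s) k
      have h10 : s = 1 / ((n : ℝ) + 1) := by rw [hs]; push_cast; rfl
      rw [← h10]
      linarith [dist_one_mul_le (φ.toFun s ^ k) (φ.toFun (t - k * s))]
    have hlim : Tendsto (fun n : ℕ ↦ C * dist 1 (φ.toFun 1) * t + ‖φ‖ * (1 / ((n : ℝ) + 1))) atTop
        (𝓝 (C * dist 1 (φ.toFun 1) * t + ‖φ‖ * 0)) :=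
      (tendsto_one_div_add_atTop_nhds_zero_nat.const_mul _).const_add _
    rw [mul_zero, add_zero] at hlim
    exact ge_of_tendsto' hlim key
  refine φ.norm_le (by positivity) fun t ↦ ?_
  rcases le_total 0 t with ht | ht
  · rw [abs_of_nonneg ht]; exact hpos t ht
  · rw [abs_of_nonpos ht, ← dist_one_inv, ← φ.map_neg]
    exact hpos (-t) (by linarith)

/-- Ultralimits of approximate homomorphisms are one-parameter subgroups. -/
theorem exists_tendsto_of_approx [ProperSpace A] (𝒰 : Ultrafilter ℕ) {f : ℕ → ℝ → A} {K : ℝ}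
    (hK : 0 ≤ K) {ε : ℕ → ℝ} (hε : Tendsto ε 𝒰 (𝓝 0)) (hε1 : ∀ i, ε i ≤ 1)
    (hf : ∀ i t, dist 1 (f i t) ≤ K * |t| + ε i)
    (hadd : ∀ i s t, dist (f i (s + t)) (f i s * f i t) ≤ ε i) :
    ∃ φ : OneParameterSubgroup A, ‖φ‖ ≤ K ∧ ∀ t, Tendsto (fun i ↦ f i t) 𝒰 (𝓝 (φ.toFun t)) := by
  have hex : ∀ t, ∃ y, Tendsto (fun i ↦ f i t) 𝒰 (𝓝 y) := by
    intro t
    obtain ⟨y, -, hy⟩ := isCompact_iff_ultrafilter_le_nhds'.1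
      (isCompact_closedBall (1 : A) (K * |t| + 1)) (𝒰.map fun i ↦ f i t)
      (by
        rw [Ultrafilter.mem_map]
        exact univ_mem' fun i ↦ by
          simp only [mem_preimage, Metric.mem_closedBall']
          linarith [hf i t, hε1 i])
    exact ⟨y, hy⟩
  choose y hy using hex
  have hbound : ∀ t, dist 1 (y t) ≤ K * |t| := by
    intro t
    have h1 : Tendsto (fun i ↦ K * |t| + ε i) 𝒰 (𝓝 (K * |t| + 0)) := hε.const_add _
    rw [add_zero] at h1
    exact le_of_tendsto_of_tendsto' ((tendsto_const_nhds (x := (1 : A))).dist (hy t)) h1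
      fun i ↦ hf i t
  refine ⟨⟨y, fun s t ↦ ?_, K, hK, hbound⟩, norm_le _ hK hbound, hy⟩
  have h1 : Tendsto (fun i ↦ f i s * f i t) 𝒰 (𝓝 (y s * y t)) := by
    rw [tendsto_iff_dist_tendsto_zero]
    have h2 : Tendsto (fun i ↦ dist (f i s) (y s) + dist (f i t) (y t)) 𝒰 (𝓝 (0 + 0)) :=
      (tendsto_iff_dist_tendsto_zero.1 (hy s)).add (tendsto_iff_dist_tendsto_zero.1 (hy t))
    rw [add_zero] at h2
    refine squeeze_zero (fun _ ↦ dist_nonneg) (fun i ↦ ?_) h2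
    refine (dist_triangle _ (y s * f i t) _).trans ?_
    rw [dist_mul_left, mul_comm (f i s), mul_comm (y s) (f i t), dist_mul_left]
  have h2 := tendsto_nhds_unique ((hy (s + t)).dist h1)
    (squeeze_zero (fun _ ↦ dist_nonneg) (fun i ↦ hadd i s t) hε)
  exact dist_eq_zero.1 h2

end OneParameterSubgroup

theorem dist_one_zpow_le {G : Type*} [Group G] [PseudoMetricSpace G] [IsIsometricSMul G G]
    (x : G) (n : ℤ) : dist 1 (x ^ n) ≤ |(n : ℝ)| * dist 1 x := by
  rcases Int.eq_nat_or_neg n with ⟨m, rfl | rfl⟩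
  · simpa using dist_one_pow_le x m
  · simpa [dist_one_inv] using dist_one_pow_le x m

namespace OneParameterSubgroup

variable {A : Type*} [CommGroup A] [MetricSpace A] [IsIsometricSMul A A]

/-- Small elements are approximated, with small relative error, by one-parameter subgroups. -/
theorem exists_approx [ProperSpace A] {C δ : ℝ} (h : IsGleasonMetric A C δ) :
    ∃ ρ > 0, ∀ z : A, dist 1 z ≤ ρ → ∃ φ : OneParameterSubgroup A,
      ‖φ‖ ≤ 2 * dist 1 z ∧ dist 1 (z * (φ.toFun 1)⁻¹) ≤ dist 1 z / 2 := by
  have hC := h.one_le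
  have hδ := h.pos
  by_contra hcon
  push Not at hcon
  -- κ ≤ δ/2 lets escape apply to w below, since n|w| ≤ n|z| + κ; κ ≤ 1 supplies the uniform error
  -- bound for the ultralimit.
  set κ : ℝ := min (δ / 2) 1 with hκ
  have hκ0 : 0 < κ := by positivity
  have hκδ : κ ≤ δ / 2 := min_le_left _ _
  have hκ1 : κ ≤ 1 := min_le_right _ _
  choose z hz hzφ using fun i : ℕ ↦ hcon (κ * (1 / ((i : ℝ) + 1))) (by positivity)
  have hzκ : ∀ i, dist 1 (z i) ≤ κ := fun i ↦ (hz i).trans (by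
    have : 1 / ((i : ℝ) + 1) ≤ 1 := by
      rw [div_le_one (by positivity)]; linarith [(Nat.cast_nonneg i : (0 : ℝ) ≤ i)]
    nlinarith)
  have hz0 : ∀ i, 0 < dist 1 (z i) := by
    intro i
    rcases (dist_nonneg (x := 1) (y := z i)).eq_or_lt with h0 | h0
    · exfalso
      have := hzφ i 0 (by simp)
      rw [eq_comm, dist_eq_zero] at h0
      simp [← h0] at this
    · exact h0
  have hzlim : Tendsto (fun i ↦ dist 1 (z i)) atTop (𝓝 0) := by
    refine squeeze_zero (fun _ ↦ dist_nonneg) hz ?_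
    have := tendsto_one_div_add_atTop_nhds_zero_nat (𝕜 := ℝ) |>.const_mul κ
    rwa [mul_zero] at this
  let 𝒰 : Ultrafilter ℕ := hyperfilter ℕ
  have h𝒰 : (𝒰 : Filter ℕ) ≤ atTop := by
    rw [← Nat.cofinite_eq_atTop]; exact hyperfilter_le_cofinite
  let n : ℕ → ℕ := fun i ↦ ⌊κ / dist 1 (z i)⌋₊
  have hn1 : ∀ i, (1 : ℝ) ≤ n i := fun i ↦ by
    have : 1 ≤ n i := Nat.le_floor (by
      rw [Nat.cast_one, le_div_iff₀ (hz0 i), one_mul]; exact hzκ i)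
    exact_mod_cast this
  have hnle : ∀ i, n i * dist 1 (z i) ≤ κ := fun i ↦ by
    have := Nat.floor_le (div_nonneg hκ0.le (hz0 i).le)
    rwa [le_div_iff₀ (hz0 i)] at this
  have hnge : ∀ i, κ ≤ 2 * n i * dist 1 (z i) := fun i ↦ by
    have := Nat.lt_floor_add_one (κ / dist 1 (z i))
    rw [div_lt_iff₀ (hz0 i)] at this
    have h2 := hn1 i
    change κ < ((n i : ℝ) + 1) * _ at this
    nlinarith [hz0 i]
  -- With n i about κ/|z i|, rounding makes t ↦ z i ^ ⌊t * n i⌋ a homomorphism up to |z i|, with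
  -- speed about κ.
  obtain ⟨φ, hφK, hφ⟩ := exists_tendsto_of_approx 𝒰 (f := fun i t ↦ z i ^ ⌊t * n i⌋) hκ0.le
    (hzlim.mono_left h𝒰) (fun i ↦ (hzκ i).trans hκ1)
    (fun i t ↦ by
      refine (dist_one_zpow_le _ _).trans ?_
      have h1 : |(⌊t * n i⌋ : ℝ)| ≤ |t| * n i + 1 := by
        have e1 := Int.floor_le (t * n i)
        have e2 := Int.lt_floor_add_one (t * n i)
        have e3 : |t * n i| = |t| * n i := by rw [abs_mul, Nat.abs_cast]
        rw [← e3, abs_le]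
        constructor <;> linarith [neg_abs_le (t * n i), le_abs_self (t * n i)]
      calc _ ≤ (|t| * n i + 1) * dist 1 (z i) := by gcongr
        _ = (n i * dist 1 (z i)) * |t| + dist 1 (z i) := by ring
        _ ≤ κ * |t| + dist 1 (z i) := by gcongr; exact hnle i)
    (fun i s t ↦ by
      rw [← zpow_add, dist_eq_dist_one_inv_mul, ← zpow_neg, ← zpow_add]
      refine (dist_one_zpow_le _ _).trans ?_
      refine mul_le_of_le_one_left dist_nonneg ?_
      rw [add_mul]
      have e1 := Int.le_floor_add (s * n i) (t * n i)
      have e2 := Int.le_floor_add_floor (s * n i) (t * n i)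
      have e3 : |-⌊s * n i + t * n i⌋ + (⌊s * n i⌋ + ⌊t * n i⌋)| ≤ 1 := by
        rw [abs_le]; constructor <;> omega
      exact_mod_cast e3)
  have hlim : Tendsto (fun i ↦ C * dist 1 (z i ^ n i * (φ.toFun 1)⁻¹)) 𝒰 (𝓝 0) := by
    have h1 := hφ 1
    simp only [one_mul, Int.floor_natCast, zpow_natCast] at h1
    have h2 := (tendsto_iff_dist_tendsto_zero.1 h1).const_mul C
    rw [mul_zero] at h2
    refine h2.congr fun i ↦ ?_
    rw [dist_comm (z i ^ n i), dist_eq_dist_one_inv_mul (φ.toFun 1), mul_comm (z i ^ n i)]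
  obtain ⟨i, hi⟩ := (hlim.eventually (gt_mem_nhds (show 0 < κ / 4 by positivity))).exists
  have hni : (0 : ℝ) < n i := by linarith [hn1 i]
  have hφi : ‖(1 / (n i : ℝ)) • φ‖ ≤ κ / n i := by
    rw [norm_smul, Real.norm_of_nonneg (by positivity), one_div, div_eq_inv_mul]
    gcongr
  have hκn : κ / n i ≤ 2 * dist 1 (z i) := by
    rw [div_le_iff₀ hni]; linarith [hnge i]
  have hbad := hzφ i ((1 / (n i : ℝ)) • φ) (hφi.trans hκn)
  -- Since A is abelian, w ^ n i = z i ^ n i * φ(1)⁻¹, which is small along the ultrafilter. Escape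
  -- gives |w| < κ/(4 n i) ≤ |z i|/2, against the choice of z i.
  set w := z i * (((1 / (n i : ℝ)) • φ).toFun 1)⁻¹ with hw
  have hwn : w ^ n i = z i ^ n i * (φ.toFun 1)⁻¹ := by
    rw [hw, mul_pow, inv_pow, smul_apply, ← φ.map_nat_mul]
    congr 3
    field_simp
  have hws : n i * dist 1 w ≤ δ := by
    have e1 : dist 1 w ≤ dist 1 (z i) + κ / n i := by
      refine (dist_one_mul_le _ _).trans ?_
      rw [dist_one_inv]
      have := dist_one_apply_one_le ((1 / (n i : ℝ)) • φ)
      linarith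
    calc n i * dist 1 w ≤ n i * (dist 1 (z i) + κ / n i) := by gcongr
      _ = n i * dist 1 (z i) + κ := by field_simp
      _ ≤ δ := by linarith [hnle i]
  have hesc := h.escape w (n i) hws
  rw [hwn] at hesc
  have h3 : n i * dist 1 w < κ / 4 := hesc.trans_lt hi
  nlinarith [hnge i]

/-- Small elements lie on one-parameter subgroups. -/
theorem exists_apply_one_eq [ProperSpace A] {C δ : ℝ} (h : IsGleasonMetric A C δ) :
    ∃ ρ > 0, ∀ z : A, dist 1 z ≤ ρ → ∃ φ : OneParameterSubgroup A,
      ‖φ‖ ≤ 4 * dist 1 z ∧ φ.toFun 1 = z := by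
  obtain ⟨ρ, hρ, happ⟩ := exists_approx h
  refine ⟨ρ, hρ, fun z hz ↦ ?_⟩
  -- Successive approximation: each correction halves the error, and the norms of the corrections
  -- sum to at most 4|z|.
  have hstep : ∀ φ : OneParameterSubgroup A, dist 1 (z * (φ.toFun 1)⁻¹) ≤ ρ →
      ∃ ψ : OneParameterSubgroup A, ‖ψ - φ‖ ≤ 2 * dist 1 (z * (φ.toFun 1)⁻¹) ∧
        dist 1 (z * (ψ.toFun 1)⁻¹) ≤ dist 1 (z * (φ.toFun 1)⁻¹) / 2 := by
    intro φ hφ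
    obtain ⟨χ, h1, h2⟩ := happ _ hφ
    refine ⟨φ + χ, by simpa using h1, ?_⟩
    rwa [add_apply, mul_inv, ← mul_assoc]
  choose! F hF1 hF2 using hstep
  let Φ : ℕ → OneParameterSubgroup A := fun k ↦ F^[k] 0
  have hΦ : ∀ k, dist 1 (z * ((Φ k).toFun 1)⁻¹) ≤ dist 1 z * (1 / 2) ^ k ∧
      ‖Φ k‖ ≤ 4 * dist 1 z * (1 - (1 / 2) ^ k) := by
    intro k
    induction k with
    | zero => simp [Φ]
    | succ k ih =>
      have hs : Φ (k + 1) = F (Φ k) := Function.iterate_succ_apply' F k 0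
      have hsmall : dist 1 (z * ((Φ k).toFun 1)⁻¹) ≤ ρ :=
        (ih.1.trans (mul_le_of_le_one_right dist_nonneg
          (pow_le_one₀ (by norm_num) (by norm_num)))).trans hz
      have h1 := hF1 _ hsmall
      have h2 := hF2 _ hsmall
      rw [hs]
      refine ⟨h2.trans (by rw [pow_succ]; linarith [ih.1]), ?_⟩
      have h3 := norm_le_norm_add_norm_sub' (F (Φ k)) (Φ k)
      rw [pow_succ]
      linarith [ih.1, ih.2]
  have hΦn : ∀ k, ‖Φ k‖ ≤ 4 * dist 1 z := fun k ↦ (hΦ k).2.trans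
    (mul_le_of_le_one_right (by positivity) (by linarith [pow_pos (by norm_num : (0:ℝ) < 1/2) k]))
  let 𝒰 : Ultrafilter ℕ := hyperfilter ℕ
  have h𝒰 : (𝒰 : Filter ℕ) ≤ atTop := by
    rw [← Nat.cofinite_eq_atTop]; exact hyperfilter_le_cofinite
  obtain ⟨φ, hφ, hlim⟩ := exists_tendsto_of_approx 𝒰 (f := fun k ↦ (Φ k).toFun)
    (K := 4 * dist 1 z) (ε := fun _ ↦ 0) (by positivity) tendsto_const_nhds (by simp)
    (fun k t ↦ by
      rw [add_zero]
      exact ((Φ k).dist_one_apply_le t).trans (by gcongr; exact hΦn k))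
    (fun k s t ↦ by rw [(Φ k).map_add', dist_self])
  refine ⟨φ, hφ, tendsto_nhds_unique (hlim 1) (Tendsto.mono_left ?_ h𝒰)⟩
  rw [tendsto_iff_dist_tendsto_zero]
  have h0 : Tendsto (fun k : ℕ ↦ dist 1 z * (1 / 2 : ℝ) ^ k) atTop (𝓝 (dist 1 z * 0)) :=
    (tendsto_pow_atTop_nhds_zero_of_lt_one (by norm_num) (by norm_num)).const_mul _
  rw [mul_zero] at h0
  refine squeeze_zero (fun _ ↦ dist_nonneg) (fun k ↦ ?_) h0
  rw [dist_eq_dist_one_inv_mul, mul_comm]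
  exact (hΦ k).1

variable (A) in
/-- The exponential map, evaluating one-parameter subgroups at time one. -/
def exp : OneParameterSubgroup A →+ Additive A where
  toFun φ := Additive.ofMul (φ.toFun 1)
  map_zero' := rfl
  map_add' _ _ := rfl

theorem exp_def (φ : OneParameterSubgroup A) : exp A φ = Additive.ofMul (φ.toFun 1) := rfl

theorem lipschitzWith_apply_one :
    LipschitzWith 1 (fun φ : OneParameterSubgroup A ↦ φ.toFun 1) := by
  refine LipschitzWith.of_dist_le_mul fun φ ψ ↦ ?_
  rw [NNReal.coe_one, one_mul, dist_eq_dist_one_inv_mul, dist_comm φ ψ, dist_eq_norm]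
  have := (ψ - φ).dist_one_apply_one_le
  rwa [sub_eq_add_neg, add_apply, neg_apply, mul_comm, ← sub_eq_add_neg] at this

theorem continuous_exp : Continuous (exp A) :=
  continuous_ofMul.comp lipschitzWith_apply_one.continuous

/-- A contractible abelian group with a proper Gleason metric is isomorphic to the space of its
one-parameter subgroups. -/
theorem bijective_exp [ProperSpace A] [IsTopologicalGroup A] [ContractibleSpace A] {C δ : ℝ}
    (h : IsGleasonMetric A C δ) : Function.Bijective (exp A) ∧ IsOpenMap (exp A) := by
  have hopen : IsOpenMap (exp A) := by
    rw [IsTopologicalAddGroup.isOpenMap_iff_nhds_zero]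
    obtain ⟨ρ, hρ, hex⟩ := exists_apply_one_eq h
    intro s hs
    rw [mem_map] at hs
    obtain ⟨r, hr, hrs⟩ := Metric.mem_nhds_iff.1 hs
    have hb : Metric.ball (1 : A) (min ρ (r / 4)) ∈ 𝓝 (1 : A) :=
      Metric.ball_mem_nhds _ (by positivity)
    have hb' : Additive.toMul ⁻¹' Metric.ball (1 : A) (min ρ (r / 4)) ∈ 𝓝 (0 : Additive A) :=
      continuous_toMul.continuousAt.preimage_mem_nhds hb
    refine mem_of_superset hb' fun x hx ↦ ?_
    rw [mem_preimage, Metric.mem_ball'] at hx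
    obtain ⟨φ, hφ, hφx⟩ := hex x.toMul (hx.le.trans (min_le_left _ _))
    have hmem : φ ∈ Metric.ball (0 : OneParameterSubgroup A) r := by
      rw [mem_ball_zero_iff]
      linarith [min_le_right ρ (r / 4)]
    have := hrs hmem
    rw [mem_preimage, exp_def, hφx] at this
    exact this
  have hconn : ConnectedSpace (Additive A) := inferInstanceAs (ConnectedSpace A)
  have hsc : SimplyConnectedSpace (Additive A) := inferInstanceAs (SimplyConnectedSpace A)
  have hsurj : Function.Surjective (exp A) := by
    rw [← AddMonoidHom.range_eq_top]
    have ho : IsOpen ((exp A).range : Set (Additive A)) := by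
      rw [AddMonoidHom.coe_range]; exact hopen.isOpen_range
    have hc : IsClosed ((exp A).range : Set (Additive A)) := AddSubgroup.isClosed_of_isOpen _ ho
    have := IsClopen.eq_univ ⟨hc, ho⟩ ⟨0, (exp A).range.zero_mem⟩
    exact SetLike.coe_injective (by simpa using this)
  have hq : IsOpenQuotientMap (exp A) := ⟨hsurj, continuous_exp, hopen⟩
  -- A kernel element of norm at most δ has norm at most C|1| = 0, so the kernel meets each δ-ball
  -- around its points only in the centre.
  have hdisc : IsDiscrete ((exp A).ker : Set (OneParameterSubgroup A)) := by
    rw [isDiscrete_iff_forall_mem_exists_isOpen]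
    intro φ hφ
    refine ⟨Metric.ball φ δ, Metric.isOpen_ball, ?_⟩
    ext ψ
    simp only [mem_inter_iff, Metric.mem_ball, SetLike.mem_coe, mem_singleton_iff]
    refine ⟨fun ⟨h1, h2⟩ ↦ ?_, fun h1 ↦ ?_⟩
    · have h3 : ψ - φ ∈ (exp A).ker := sub_mem h2 hφ
      rw [AddMonoidHom.mem_ker] at h3
      have h4 : (ψ - φ).toFun 1 = 1 := h3
      have h5 := norm_le_of_norm_le h (ψ - φ) (by rw [← dist_eq_norm]; exact h1.le)
      rw [h4, dist_self, mul_zero] at h5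
      exact sub_eq_zero.1 (norm_le_zero_iff.1 h5)
    · rw [h1]; exact ⟨by simpa using h.pos, hφ⟩
  have hcov : IsCoveringMap (exp A) :=
    (hq.isQuotientMap.isAddQuotientCoveringMap_of_isDiscrete_ker_addMonoidHom hdisc).isCoveringMap
  have hlpc : LocallyPathConnectedSpace (Additive A) := hq.isQuotientMap.locallyPathConnectedSpace
  -- A is simply connected, so the identity lifts through the covering; uniqueness of lifts makes
  -- the lift a left inverse of `exp`.
  obtain ⟨F, ⟨hF0, hF⟩, -⟩ := hcov.existsUnique_continuousMap_lifts (ContinuousMap.id (Additive A))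
    0 0 (AddMonoidHom.map_zero _)
  have hinv : F ∘ exp A = id := by
    refine hcov.eq_of_comp_eq (F.continuous.comp continuous_exp) continuous_id ?_ 0 ?_
    · rw [← Function.comp_assoc, hF]; rfl
    · simpa using hF0
  exact ⟨⟨(Function.leftInverse_iff_comp.2 hinv).injective, hsurj⟩, hopen⟩

end OneParameterSubgroup

/-! ### Properness and the splitting of G over A -/

open scoped Pointwise in
/-- A locally compact length group is proper. -/
theorem IsLengthGroup.properSpace {G : Type*} [Group G] [PseudoMetricSpace G]
    [IsIsometricSMul G G] [ContinuousMul G] [LocallyCompactSpace G] (hl : IsLengthGroup G) :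
    ProperSpace G := by
  obtain ⟨K, hK, hK1⟩ := exists_compact_mem_nhds (1 : G)
  obtain ⟨ε, hε, hεK⟩ := Metric.mem_nhds_iff.1 hK1
  have hcov : ∀ n : ℕ, ∃ L : Set G, IsCompact L ∧ ∀ g, dist 1 g < (n + 1) * ε → g ∈ L := by
    intro n
    induction n with
    | zero =>
      exact ⟨K, hK, fun g hg ↦ hεK (by rw [Metric.mem_ball']; simpa using hg)⟩
    | succ n ih =>
      obtain ⟨L, hL, hLg⟩ := ih
      refine ⟨L * K, hL.mul hK, fun g hg ↦ ?_⟩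
      obtain ⟨h, k, rfl, hh, hk⟩ := hl g ((n + 1) * ε) ε (by positivity) hε
        (by push_cast at hg; linarith)
      exact Set.mul_mem_mul (hLg h hh) (hεK (by rwa [Metric.mem_ball']))
  have hball : ∀ R, IsCompact (Metric.closedBall (1 : G) R) := by
    intro R
    obtain ⟨n, hn⟩ := exists_nat_gt (R / ε)
    rw [div_lt_iff₀ hε] at hn
    obtain ⟨L, hL, hLg⟩ := hcov n
    refine IsCompact.of_isClosed_subset hL.closure Metric.isClosed_closedBall
      fun g hg ↦ subset_closure (hLg g ?_)
    rw [Metric.mem_closedBall'] at hg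
    linarith
  refine ⟨fun x R ↦ ?_⟩
  have : Metric.closedBall x R = (fun y ↦ x * y) '' Metric.closedBall 1 R := by
    ext y
    simp only [Metric.mem_closedBall', mem_image]
    refine ⟨fun hy ↦ ⟨x⁻¹ * y, ?_, by simp⟩, ?_⟩
    · rwa [← dist_eq_dist_one_inv_mul]
    · rintro ⟨z, hz, rfl⟩
      rwa [dist_eq_dist_one_inv_mul, inv_mul_cancel_left]
  rw [this]
  exact (hball R).image (continuous_const_mul x)

/-- The projection of a semidirect product `U ⋊ A` of closed subgroups onto `A` is continuous. -/
theorem exists_continuous_projection {G : Type*} [Group G] [TopologicalSpace G]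
    [IsTopologicalGroup G] [T2Space G] [LocallyCompactSpace G] [SigmaCompactSpace G]
    {U A : Subgroup G} (hU : IsClosed (U : Set G)) (hA : IsClosed (A : Set G)) (hn : U.Normal)
    (hUA : U.IsComplement' A) :
    ∃ pr : G →* A, Continuous pr ∧ (∀ a : A, pr a = a) ∧ pr.ker = U := by
  have hex : ∀ g : G, ∃ a : A, g * (a : G)⁻¹ ∈ U := by
    intro g
    obtain ⟨⟨u, a⟩, h⟩ := hUA.2 g
    refine ⟨a, ?_⟩
    simp only [← h, mul_inv_cancel_right]
    exact u.2
  have huniq : ∀ (g : G) (a b : A), g * (a : G)⁻¹ ∈ U → g * (b : G)⁻¹ ∈ U → a = b := by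
    intro g a b ha hb
    have := @hUA.1 (⟨_, ha⟩, a) (⟨_, hb⟩, b) (by simp)
    exact congrArg Prod.snd this
  choose p hp using hex
  have hpm : ∀ g h, p (g * h) = p g * p h := by
    intro g h
    refine huniq (g * h) _ _ (hp _) ?_
    have h1 := hn.conj_mem _ (hp h) (p g : G)
    have h2 := U.mul_mem (hp g) h1
    convert h2 using 1
    push_cast
    group
  let pr : G →* A := MonoidHom.mk' p hpm
  refine ⟨pr, ?_, fun a ↦ huniq a _ _ (hp _) (by simp), ?_⟩
  -- Let U × A act by g ↦ u g a⁻¹. The action is transitive, so by the open mapping theorem for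
  -- σ-compact groups (u, a) ↦ u a⁻¹ is open. A preimage under `pr` is the image of an open set in
  -- which the A-component is inverted.
  · let _ : MulAction (U × A) G :=
      { smul := fun q g ↦ (q.1 : G) * g * (q.2 : G)⁻¹
        one_smul := fun g ↦ by
          change ((1 : U × A).1 : G) * g * ((1 : U × A).2 : G)⁻¹ = g
          simp
        mul_smul := fun q r g ↦ by
          change ((q * r).1 : G) * g * ((q * r).2 : G)⁻¹ =
            (q.1 : G) * ((r.1 : G) * g * (r.2 : G)⁻¹) * (q.2 : G)⁻¹
          simp [mul_assoc] }
    have hsmul : ∀ (q : U × A) (g : G), q • g = (q.1 : G) * g * (q.2 : G)⁻¹ := fun _ _ ↦ rfl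
    have : ContinuousSMul (U × A) G := by
      refine ⟨?_⟩
      simp only [hsmul]
      fun_prop
    have hone : ∀ g : G, ∃ q : U × A, q • (1 : G) = g := fun g ↦
      ⟨(⟨_, hp g⟩, (p g)⁻¹), by rw [hsmul]; simp⟩
    have : MulAction.IsPretransitive (U × A) G := by
      refine ⟨fun x y ↦ ?_⟩
      obtain ⟨q, rfl⟩ := hone x
      obtain ⟨r, rfl⟩ := hone y
      exact ⟨r * q⁻¹, by rw [mul_smul, inv_smul_smul]⟩
    have : SigmaCompactSpace U := hU.isClosedEmbedding_subtypeVal.sigmaCompactSpace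
    have : SigmaCompactSpace A := hA.isClosedEmbedding_subtypeVal.sigmaCompactSpace
    have hopen := isOpenMap_smul_of_sigmaCompact (G := U × A) (1 : G)
    refine continuous_def.2 fun O hO ↦ ?_
    have hO' : IsOpen (univ ×ˢ ((fun a : A ↦ a⁻¹) ⁻¹' O) : Set (U × A)) :=
      isOpen_univ.prod (hO.preimage continuous_inv)
    convert hopen _ hO' using 1
    ext g
    simp only [mem_preimage, mem_image, mem_prod, mem_univ, true_and, hsmul, mul_one]
    refine ⟨fun hg ↦ ⟨(⟨_, hp g⟩, (p g)⁻¹), ?_, by simp⟩, ?_⟩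
    · rw [inv_inv]; exact hg
    · rintro ⟨⟨u, a⟩, ha, rfl⟩
      have : pr ((u : G) * (a : G)⁻¹) = a⁻¹ := huniq _ _ _ (hp _) (by simp)
      rwa [this]
  · ext g
    rw [MonoidHom.mem_ker]
    change p g = 1 ↔ _
    refine ⟨fun h ↦ ?_, fun h ↦ huniq g _ _ (hp g) (by simpa using h)⟩
    have := hp g
    rw [h] at this
    simpa using this

/-- A splitting `e : V → G` of a homomorphism `ℓ` from a metric group onto a normed space, with
metric control on both maps. -/
structure IsMetricSplitting {G V : Type*} [Group G] [PseudoMetricSpace G] [NormedAddCommGroup V]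
    (e : V → G) (ℓ : G → V) (C : ℝ) : Prop where
  one_le : 1 ≤ C
  map_add : ∀ v w, e (v + w) = e v * e w
  dist_le : ∀ v, dist 1 (e v) ≤ ‖v‖
  log_exp : ∀ v, ℓ (e v) = v
  log_mul : ∀ g h, ℓ (g * h) = ℓ g + ℓ h
  norm_log_le : ∀ g, ‖ℓ g‖ ≤ C * dist 1 g

/-- A continuous homomorphism from a length group to a normed space is Lipschitz. -/
theorem IsLengthGroup.exists_norm_le_mul {G V : Type*} [Group G] [MetricSpace G]
    [IsIsometricSMul G G] [NormedAddCommGroup V] [NormedSpace ℝ V] (hl : IsLengthGroup G)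
    {ℓ : G → V} (hℓ : ContinuousAt ℓ 1) (hmul : ∀ g h, ℓ (g * h) = ℓ g + ℓ h) :
    ∃ C : ℝ, 1 ≤ C ∧ ∀ g, ‖ℓ g‖ ≤ C * dist 1 g := by
  have h1 : ℓ 1 = 0 := by simpa using hmul 1 1
  have hpow : ∀ (g : G) (n : ℕ), ℓ (g ^ n) = (n : ℝ) • ℓ g := by
    intro g n
    induction n with
    | zero => simp [h1]
    | succ n ih => rw [pow_succ, hmul, ih]; push_cast; rw [add_smul, one_smul]
  obtain ⟨δ, hδ, hb⟩ := Metric.continuousAt_iff.1 hℓ 1 one_pos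
  refine ⟨max 1 (4 / δ), by simp, hl.le_mul_of_subadditive (ε := δ / 2) ?_ (by positivity)
    (by positivity) ?_⟩
  · intro x y
    rw [hmul]
    exact norm_add_le _ _
  · intro g hg
    rcases (dist_nonneg (x := (1 : G)) (y := g)).eq_or_lt with h0 | h0
    · rw [eq_comm, dist_eq_zero] at h0
      simp [← h0, h1]
    -- For this n, g^n stays in the δ-ball, so n‖ℓ g‖ = ‖ℓ (g^n)‖ < 1, while n is at least δ/(4|g|).
    have hn1 : 1 ≤ ⌊δ / (2 * dist 1 g)⌋₊ := Nat.le_floor (by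
      rw [Nat.cast_one, le_div_iff₀ (by positivity)]; linarith)
    have hn2 := Nat.floor_le (show 0 ≤ δ / (2 * dist 1 g) by positivity)
    have hn3 := Nat.lt_floor_add_one (δ / (2 * dist 1 g))
    set n := ⌊δ / (2 * dist 1 g)⌋₊
    have hn1' : (1 : ℝ) ≤ n := by exact_mod_cast hn1
    rw [le_div_iff₀ (by positivity)] at hn2
    rw [div_lt_iff₀ (by positivity)] at hn3
    have h2 := hb (x := g ^ n) (by rw [dist_comm]; linarith [dist_one_pow_le g n])
    rw [h1, dist_zero_right, hpow, norm_smul, Real.norm_natCast] at h2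
    have h3 : ‖ℓ g‖ ≤ 4 / δ * dist 1 g := by
      rw [div_mul_eq_mul_div, le_div_iff₀ hδ]
      have h4 : δ ≤ 4 * n * dist 1 g := by nlinarith
      calc ‖ℓ g‖ * δ ≤ ‖ℓ g‖ * (4 * n * dist 1 g) := by gcongr
        _ = 4 * dist 1 g * (n * ‖ℓ g‖) := by ring
        _ ≤ 4 * dist 1 g * 1 := by gcongr
        _ = 4 * dist 1 g := mul_one _
    exact h3.trans (by gcongr; simp)

/-- A continuous retraction of a length group onto a contractible abelian group with a Gleason
metric gives rise to a metric splitting. -/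
theorem exists_isMetricSplitting {G A : Type*} [Group G] [MetricSpace G] [IsIsometricSMul G G]
    [CommGroup A] [MetricSpace A] [IsIsometricSMul A A] [ProperSpace A] [IsTopologicalGroup A]
    [ContractibleSpace A] (hl : IsLengthGroup G) {C δ : ℝ} (hA : IsGleasonMetric A C δ)
    {pr : G →* A} {ι : A →* G} (hpr : Continuous pr) (hι : Isometry ι) (hprι : ∀ a, pr (ι a) = a) :
    ∃ (e : OneParameterSubgroup A → G) (ℓ : G → OneParameterSubgroup A) (C : ℝ),
      IsMetricSplitting e ℓ C ∧ (∀ g, ℓ g = 0 ↔ pr g = 1) ∧ ∀ a, e (ℓ (ι a)) = ι a := by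
  obtain ⟨hbij, hopen⟩ := OneParameterSubgroup.bijective_exp hA
  let ex : OneParameterSubgroup A ≃+ Additive A :=
    AddEquiv.ofBijective (OneParameterSubgroup.exp A) hbij
  have hex : ∀ φ, ex φ = Additive.ofMul (φ.toFun 1) := fun _ ↦ rfl
  have hcont : Continuous ex.symm := by
    let hh := (Equiv.ofBijective _ hbij).toHomeomorphOfContinuousOpen
      OneParameterSubgroup.continuous_exp hopen
    exact hh.symm.continuous
  let ℓ : G → OneParameterSubgroup A := fun g ↦ ex.symm (Additive.ofMul (pr g))
  have hmul : ∀ g h, ℓ (g * h) = ℓ g + ℓ h := fun g h ↦ by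
    simp only [ℓ, map_mul, ofMul_mul, map_add]
  have hℓ : Continuous ℓ := hcont.comp (continuous_ofMul.comp hpr)
  obtain ⟨C', hC', hC'ℓ⟩ := hl.exists_norm_le_mul hℓ.continuousAt hmul
  refine ⟨fun φ ↦ ι (φ.toFun 1), ℓ, C', ⟨hC', fun v w ↦ ?_, fun v ↦ ?_, fun v ↦ ?_, hmul, hC'ℓ⟩,
    fun g ↦ ?_, fun a ↦ ?_⟩
  · rw [OneParameterSubgroup.add_apply, map_mul]
  · rw [← map_one ι, hι.dist_eq]
    exact v.dist_one_apply_one_le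
  · simp only [ℓ, hprι, ← hex, AddEquiv.symm_apply_apply]
  · simp only [ℓ, map_eq_zero_iff _ ex.symm.injective]
    rfl
  · have : ex (ℓ (ι a)) = Additive.ofMul a := by simp only [ℓ, hprι, AddEquiv.apply_symm_apply]
    rw [hex] at this
    exact congrArg ι (Additive.ofMul.injective this)

/-- Both conditions involve only norms and products of the elements concerned; this carries the
chart estimates from G to A. -/
theorem IsGleasonMetric.subgroup {G : Type*} [Group G] [PseudoMetricSpace G] {C δ : ℝ}
    (h : IsGleasonMetric G C δ) (A : Subgroup G) : IsGleasonMetric A C δ :=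
  ⟨h.one_le, h.pos, fun g n hn ↦ h.escape g n hn, fun x y hx hy ↦ h.commutator x y hx hy⟩

/-! ### Unipotence and vacuum subsets: contraction near the identity -/

/-- Cayley–Hamilton, the characteristic polynomial being (X - 1)^n. -/
theorem Matrix.isNilpotent_sub_one_of_isUpperTriangular {n : ℕ} {M : Matrix (Fin n) (Fin n) ℝ}
    (hM : M.IsUpperTriangular) (hd : ∀ i, M i i = 1) : IsNilpotent (M - 1) := by
  refine ⟨n, ?_⟩
  have h := M.aeval_self_charpoly
  rw [Matrix.charpoly_of_isUpperTriangular M hM] at h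
  simpa [hd] using h

/-- A unipotent matrix with bounded powers is trivial. -/
theorem Matrix.eq_one_of_pow_mem_isCompact {n : ℕ} {M : Matrix (Fin n) (Fin n) ℝ}
    (hM : IsNilpotent (M - 1)) {K : Set (Matrix (Fin n) (Fin n) ℝ)} (hK : IsCompact K)
    (hpow : ∀ j : ℕ, M ^ j ∈ K) : M = 1 := by
  by_contra hne
  set N := M - 1 with hN
  have hN0 : N ≠ 0 := sub_ne_zero.2 hne
  have hnt : Nontrivial (Matrix (Fin n) (Fin n) ℝ) := ⟨⟨_, _, hne⟩⟩
  have hcl := pow_nilpotencyClass hM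
  have hpos := pos_nilpotencyClass_iff.2 hM
  have h1 : nilpotencyClass N ≠ 1 := fun h ↦ by
    rw [h, pow_one] at hcl
    exact hN0 hcl
  obtain ⟨p, hp⟩ : ∃ p, nilpotencyClass N = p + 2 := ⟨nilpotencyClass N - 2, by omega⟩
  have hNp : N ^ (p + 1) ≠ 0 := by
    have := pow_pred_nilpotencyClass hM
    rwa [hp] at this
  rw [hp] at hcl
  -- Multiplying by N^p kills every binomial term of degree above one, as N^(p+2) = 0; what remains
  -- grows linearly in j.
  have hform : ∀ j : ℕ, N ^ p * M ^ j = N ^ p + (j : ℝ) • N ^ (p + 1) := by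
    intro j
    induction j with
    | zero => simp
    | succ j ih =>
      have hM1 : M = 1 + N := by rw [hN]; abel
      rw [pow_succ, ← mul_assoc, ih, hM1, mul_add, mul_one, add_mul, smul_mul_assoc, ← pow_succ,
        ← pow_succ, hcl, smul_zero, add_zero]
      push_cast
      rw [add_smul, one_smul]
      abel
  obtain ⟨a, b, hab⟩ : ∃ a b, (N ^ (p + 1)) a b ≠ 0 := by
    by_contra hcon
    push Not at hcon
    exact hNp (Matrix.ext hcon)
  have hcont : Continuous fun X : Matrix (Fin n) (Fin n) ℝ ↦ (N ^ p * X) a b := by fun_prop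
  obtain ⟨B, hB⟩ := hK.exists_bound_of_continuousOn hcont.continuousOn
  obtain ⟨j, hj⟩ := exists_nat_gt ((B + |(N ^ p) a b|) / |(N ^ (p + 1)) a b|)
  rw [div_lt_iff₀ (abs_pos.2 hab)] at hj
  have h2 := hB _ (hpow j)
  rw [hform, Matrix.add_apply, Matrix.smul_apply, smul_eq_mul, Real.norm_eq_abs] at h2
  have h3 := abs_sub_abs_le_abs_sub ((j : ℝ) * (N ^ (p + 1)) a b) (-(N ^ p) a b)
  rw [sub_neg_eq_add, abs_neg, abs_mul, Nat.abs_cast, add_comm ((j : ℝ) * _)] at h3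
  linarith

/-- In a real unipotent group only the identity has all its powers in a compact set. -/
theorem IsRealUnipotent.eq_one_of_pow_mem_isCompact {U : Type*} [Group U] [TopologicalSpace U]
    (hU : IsRealUnipotent U) {K : Set U} (hK : IsCompact K) {u : U} (hu : ∀ j : ℕ, u ^ j ∈ K) :
    u = 1 := by
  obtain ⟨n, ρ, hρ, htri⟩ := hU
  refine hρ.injective ?_
  rw [map_one]
  refine Matrix.eq_one_of_pow_mem_isCompact
    (Matrix.isNilpotent_sub_one_of_isUpperTriangular (htri u).1 (htri u).2)
    (hK.image hρ.continuous) fun j ↦ ?_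
  rw [← map_pow]
  exact mem_image_of_mem ρ (hu j)

theorem conj_iterate {G : Type*} [Group G] (a x : G) (n : ℕ) :
    (fun x ↦ a⁻¹ * x * a)^[n] x = (a ^ n)⁻¹ * x * a ^ n := by
  induction n with
  | zero => simp
  | succ n ih => rw [Function.iterate_succ_apply', ih, pow_succ]; group

theorem conj_pow_eq {G : Type*} [Group G] (b x : G) (k : ℕ) :
    (b⁻¹ * x * b) ^ k = b⁻¹ * x ^ k * b := by
  simpa using conj_pow (i := k) (a := b⁻¹) (b := x)

/-- A vacuum subset in a real unipotent group forces all compact sets to be eventually contracted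
to the identity. -/
theorem IsVacuumSubset.exists_dist_one_conj_lt {G : Type*} [Group G] [MetricSpace G]
    [IsTopologicalGroup G] {U : Subgroup G} (hun : IsRealUnipotent U) {a : G} {Ω : Set G}
    (hΩ : IsVacuumSubset U a Ω) {K : Set G} (hK : IsCompact K) (hKU : K ⊆ U) {ε : ℝ}
    (hε : 0 < ε) : ∃ n : ℕ, 0 < n ∧ ∀ u ∈ K, dist 1 ((a ^ n)⁻¹ * u * a ^ n) < ε := by
  obtain ⟨hΩc, hΩU, hvac⟩ := hΩ
  by_contra hcon
  push Not at hcon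
  have hm : ∀ m : ℕ, ∃ w ∈ Ω, ε ≤ dist 1 w ∧ ∀ j ≤ m, w ^ j ∈ Ω := by
    intro m
    -- One exponent n serves all powers of K up to m + 1; the extra one keeps the first power
    -- available when m = 0.
    obtain ⟨n, hn, hsub⟩ := hvac (⋃ j ∈ Iic (m + 1), (fun u ↦ u ^ j) '' K)
      ((finite_Iic (m + 1)).isCompact_biUnion fun j _ ↦ hK.image (continuous_pow j))
      (by
        simp only [iUnion_subset_iff]
        rintro j - _ ⟨u, hu, rfl⟩
        exact U.pow_mem (hKU hu) j)
    obtain ⟨u, hu, hue⟩ := hcon n hn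
    have hpow : ∀ j ≤ m + 1, ((a ^ n)⁻¹ * u * a ^ n) ^ j ∈ Ω := fun j hj ↦ by
      refine hsub ⟨u ^ j, mem_biUnion (show j ∈ Iic (m + 1) from hj) ⟨u, hu, rfl⟩, ?_⟩
      rw [conj_iterate, conj_pow_eq]
    exact ⟨_, by simpa using hpow 1 (by omega), hue, fun j hj ↦ hpow j (by omega)⟩
  choose w hwΩ hwε hwj using hm
  let 𝒰 : Ultrafilter ℕ := hyperfilter ℕ
  have h𝒰 : (𝒰 : Filter ℕ) ≤ atTop := by
    rw [← Nat.cofinite_eq_atTop]; exact hyperfilter_le_cofinite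
  obtain ⟨v, hvΩ, hv⟩ := isCompact_iff_ultrafilter_le_nhds'.1 hΩc (𝒰.map w)
    (by rw [Ultrafilter.mem_map]; exact univ_mem' hwΩ)
  have hv' : Tendsto w 𝒰 (𝓝 v) := hv
  have hvj : ∀ j : ℕ, v ^ j ∈ Ω := fun j ↦
    hΩc.isClosed.mem_of_tendsto (hv'.pow j)
      (h𝒰 ((eventually_ge_atTop j).mono fun m hm ↦ hwj m j hm))
  have hvε : ε ≤ dist 1 v := ge_of_tendsto' ((tendsto_const_nhds (x := (1 : G))).dist hv') hwε
  have h1 : (⟨v, hΩU hvΩ⟩ : U) = 1 := by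
    refine hun.eq_one_of_pow_mem_isCompact (K := ((↑) : U → G) ⁻¹' Ω) ?_ fun j ↦ by simpa using hvj j
    refine Topology.IsInducing.subtypeVal.isCompact_preimage' hΩc ?_
    simpa using hΩU
  have h2 : v = 1 := congrArg Subtype.val h1
  rw [h2, dist_self] at hvε
  linarith

/-- For a Gleason metric, a vacuum subset of a real unipotent group yields a linear contraction near
the identity. -/
theorem IsVacuumSubset.exists_dist_one_conj_le_half {G : Type*} [Group G] [MetricSpace G]
    [IsIsometricSMul G G] [IsTopologicalGroup G] [ProperSpace G] {C δ : ℝ}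
    (hg : IsGleasonMetric G C δ) {U : Subgroup G} (hUc : IsClosed (U : Set G))
    (hun : IsRealUnipotent U) {a : G} {Ω : Set G} (hΩ : IsVacuumSubset U a Ω) :
    ∃ n : ℕ, 0 < n ∧ ∀ u ∈ U, dist 1 u ≤ δ →
      dist 1 ((a ^ n)⁻¹ * u * a ^ n) ≤ dist 1 u / 2 := by
  have hC := hg.one_le
  have hδ := hg.pos
  set ε : ℝ := δ / (4 * (C + 1)) with hε
  have hε0 : 0 < ε := by positivity
  have hεC : 4 * ((C + 1) * ε) = δ := by rw [hε]; field_simp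
  obtain ⟨n, hn, hnK⟩ := hΩ.exists_dist_one_conj_lt hun
    (K := Metric.closedBall 1 δ ∩ U) ((isCompact_closedBall _ _).inter_right hUc)
    inter_subset_right hε0
  refine ⟨n, hn, fun u hu huδ ↦ ?_⟩
  rcases (dist_nonneg (x := (1 : G)) (y := u)).eq_or_lt with h0 | h0
  · rw [eq_comm, dist_eq_zero] at h0
    simp [← h0]
  have hM1 : 1 ≤ ⌊δ / dist 1 u⌋₊ := Nat.le_floor (by
    rw [Nat.cast_one, le_div_iff₀ h0, one_mul]; exact huδ)
  have hM2 := Nat.floor_le (show 0 ≤ δ / dist 1 u by positivity)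
  have hM3 := Nat.lt_floor_add_one (δ / dist 1 u)
  set M := ⌊δ / dist 1 u⌋₊
  rw [le_div_iff₀ h0] at hM2
  rw [div_lt_iff₀ h0] at hM3
  have hM1' : (1 : ℝ) ≤ M := by exact_mod_cast hM1
  -- The powers of u up to M ≈ δ/|u| stay in the δ-ball and are all sent within ε of 1. Their common
  -- smallness forces the conjugate to have norm at most Cε/M ≤ δ/(4M) ≤ |u|/2.
  have key := hg.mul_dist_one_le (η := ε) (by nlinarith) ((a ^ n)⁻¹ * u * a ^ n) M
    fun k hk ↦ by
      rw [conj_pow_eq]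
      refine (hnK _ ⟨?_, U.pow_mem hu k⟩).le
      rw [Metric.mem_closedBall']
      refine (dist_one_pow_le u k).trans (le_trans ?_ hM2)
      gcongr
  have h4 : δ ≤ 2 * M * dist 1 u := by nlinarith
  set D := dist 1 ((a ^ n)⁻¹ * u * a ^ n)
  have h5 : M * D ≤ δ / 4 := by nlinarith
  have h6 : M * D ≤ M * (dist 1 u / 2) := by linarith
  exact le_of_mul_le_mul_left h6 (by linarith)

/-! ### The contracting flow on the kernel of ℓ -/

/-- Conjugation by the exponential of a vector. -/
def conjExp {G V : Type*} [Group G] [Neg V] (e : V → G) (v : V) (u : G) : G := e (-v) * u * e v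

namespace IsMetricSplitting

variable {G V : Type*} [Group G] [MetricSpace G] [NormedAddCommGroup V] {e : V → G} {ℓ : G → V}
  {L : ℝ}

theorem map_zero (h : IsMetricSplitting e ℓ L) : e 0 = 1 := by
  simpa using h.map_add 0 0

theorem map_neg (h : IsMetricSplitting e ℓ L) (v : V) : e (-v) = (e v)⁻¹ := by
  rw [eq_inv_iff_mul_eq_one, ← h.map_add, neg_add_cancel, h.map_zero]

theorem log_one (h : IsMetricSplitting e ℓ L) : ℓ 1 = 0 := by
  simpa using h.log_mul 1 1

theorem log_inv (h : IsMetricSplitting e ℓ L) (g : G) : ℓ g⁻¹ = -ℓ g := by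
  rw [eq_neg_iff_add_eq_zero, ← h.log_mul, inv_mul_cancel, h.log_one]

theorem conjExp_eq (h : IsMetricSplitting e ℓ L) (v : V) (u : G) :
    conjExp e v u = (e v)⁻¹ * u * e v := by rw [conjExp, h.map_neg]

theorem conjExp_zero (h : IsMetricSplitting e ℓ L) (u : G) : conjExp e 0 u = u := by
  simp [h.conjExp_eq, h.map_zero]

theorem conjExp_add (h : IsMetricSplitting e ℓ L) (v w : V) (u : G) :
    conjExp e (v + w) u = conjExp e w (conjExp e v u) := by
  simp only [h.conjExp_eq, h.map_add]; group

theorem conjExp_comm (h : IsMetricSplitting e ℓ L) (v w : V) (u : G) :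
    conjExp e w (conjExp e v u) = conjExp e v (conjExp e w u) := by
  rw [← h.conjExp_add, ← h.conjExp_add, add_comm]

theorem conjExp_mul (h : IsMetricSplitting e ℓ L) (v : V) (u w : G) :
    conjExp e v (u * w) = conjExp e v u * conjExp e v w := by
  simp only [h.conjExp_eq]; group

theorem conjExp_inv (h : IsMetricSplitting e ℓ L) (v : V) (u : G) :
    conjExp e v u⁻¹ = (conjExp e v u)⁻¹ := by
  simp only [h.conjExp_eq]; group

theorem log_conjExp (h : IsMetricSplitting e ℓ L) (v : V) (u : G) : ℓ (conjExp e v u) = ℓ u := by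
  rw [conjExp, h.log_mul, h.log_mul, h.log_exp, h.log_exp]; abel

theorem log_mul_exp_neg (h : IsMetricSplitting e ℓ L) (g : G) : ℓ (g * e (-ℓ g)) = 0 := by
  rw [h.log_mul, h.log_exp, add_neg_cancel]

theorem dist_conjExp [IsIsometricSMul G G] (h : IsMetricSplitting e ℓ L) (v : V) (u w : G) :
    dist (conjExp e v u) (conjExp e v w) = dist 1 (conjExp e v (u⁻¹ * w)) := by
  rw [dist_eq_dist_one_inv_mul, ← h.conjExp_inv, ← h.conjExp_mul]

/-- g * e (-ℓ g) is the kernel component of g, through which estimates on the kernel reach all of G.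
-/
theorem dist_one_mul_exp_neg_le [IsIsometricSMul G G] (h : IsMetricSplitting e ℓ L) (g : G) :
    dist 1 (g * e (-ℓ g)) ≤ (L + 1) * dist 1 g := by
  have h1 := dist_one_mul_le g (e (-ℓ g))
  have h2 := h.dist_le (-ℓ g)
  rw [norm_neg] at h2
  linarith [h.norm_log_le g]

variable [IsIsometricSMul G G] [NormedSpace ℝ V] {C δ : ℝ}

/-- Conjugation by `e v` expands small elements at most by a factor exponential in `‖v‖`. -/
theorem dist_one_conjExp_le (h : IsMetricSplitting e ℓ L) (hg : IsGleasonMetric G C δ) (v : V)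
    {u : G} (hu : Real.exp (C * ‖v‖) * dist 1 u ≤ δ) :
    dist 1 (conjExp e v u) ≤ Real.exp (C * ‖v‖) * dist 1 u := by
  have hC := hg.one_le
  have hδ := hg.pos
  -- Cut v into m equal steps of norm at most δ; each expands by at most 1 + C‖w‖ ≤ exp (C‖w‖), and
  -- the hypothesis keeps all intermediate elements in the δ-ball.
  obtain ⟨m, hm⟩ := exists_nat_gt (‖v‖ / δ)
  have hm0 : (0 : ℝ) < m := lt_of_le_of_lt (by positivity) hm
  rw [div_lt_iff₀ hδ] at hm
  set w : V := (1 / (m : ℝ)) • v with hw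
  have hwn : ‖w‖ = ‖v‖ / m := by
    rw [hw, norm_smul, Real.norm_of_nonneg (by positivity), one_div, div_eq_inv_mul]
  have hwδ : ‖w‖ ≤ δ := by rw [hwn, div_le_iff₀ hm0]; linarith
  have key : ∀ k ≤ m, dist 1 (conjExp e ((k : ℝ) • w) u) ≤ Real.exp (C * (k * ‖w‖)) * dist 1 u := by
    intro k
    induction k with
    | zero => intro _; simp [h.conjExp_zero]
    | succ k ih =>
      intro hk
      have h1 := ih (by omega)
      have hkm : (k : ℝ) * ‖w‖ ≤ ‖v‖ := by
        rw [hwn, mul_div_assoc', div_le_iff₀ hm0, mul_comm]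
        have : (k : ℝ) ≤ m := by exact_mod_cast (by omega : k ≤ m)
        gcongr
      have h2 : dist 1 (conjExp e ((k : ℝ) • w) u) ≤ δ :=
        h1.trans (le_trans (by gcongr) hu)
      have h3 := hg.dist_one_conj_le (x := e w) ((h.dist_le w).trans hwδ) h2
      rw [← h.conjExp_eq, ← h.conjExp_add] at h3
      have e1 : (k : ℝ) • w + w = ((k + 1 : ℕ) : ℝ) • w := by
        push_cast; rw [add_smul, one_smul]
      rw [e1] at h3
      have h4 : 1 + C * dist 1 (e w) ≤ Real.exp (C * ‖w‖) := by
        have := Real.add_one_le_exp (C * ‖w‖)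
        have := mul_le_mul_of_nonneg_left (h.dist_le w) (show 0 ≤ C by linarith)
        linarith
      calc _ ≤ _ := h3
        _ ≤ Real.exp (C * ‖w‖) * (Real.exp (C * (k * ‖w‖)) * dist 1 u) := by gcongr
        _ = Real.exp (C * (((k + 1 : ℕ) : ℝ) * ‖w‖)) * dist 1 u := by
          rw [← mul_assoc, ← Real.exp_add]; congr 2; push_cast; ring
  have h5 := key m le_rfl
  have e2 : (m : ℝ) • w = v := by rw [hw, smul_smul, mul_one_div_cancel hm0.ne', one_smul]
  have e3 : (m : ℝ) * ‖w‖ = ‖v‖ := by rw [hwn]; field_simp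
  rwa [e2, e3] at h5

/-- A single contracting step propagates to an exponential contraction along the flow. -/
theorem exists_exp_contraction (h : IsMetricSplitting e ℓ L) (hg : IsGleasonMetric G C δ) {a : V}
    {T : ℝ} (hT : 0 < T)
    (hcon : ∀ u, ℓ u = 0 → dist 1 u ≤ δ → dist 1 (conjExp e (T • a) u) ≤ dist 1 u / 2) :
    ∃ B c η : ℝ, 1 ≤ B ∧ 0 < c ∧ 0 < η ∧ ∀ u, ℓ u = 0 → dist 1 u ≤ η → ∀ s, 0 ≤ s →
      dist 1 (conjExp e (s • a) u) ≤ B * Real.exp (-(c * s)) * dist 1 u := by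
  have hC := hg.one_le
  have hδ := hg.pos
  set E := Real.exp (C * (T * ‖a‖)) with hE
  have hE1 : 1 ≤ E := Real.one_le_exp (by positivity)
  -- E bounds the expansion during an incomplete period of length at most T, and the 2 compensates
  -- for rounding s/T down.
  refine ⟨2 * E, Real.log 2 / T, δ / E, by linarith, by positivity, by positivity,
    fun u hu hus s hs ↦ ?_⟩
  rw [le_div_iff₀ (by positivity)] at hus
  have huδ : dist 1 u ≤ δ := by nlinarith [dist_nonneg (x := (1 : G)) (y := u)]
  have hiter : ∀ q : ℕ, dist 1 (conjExp e (((q : ℝ) * T) • a) u) ≤ (1 / 2) ^ q * dist 1 u := by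
    intro q
    induction q with
    | zero => simp [h.conjExp_zero]
    | succ q ih =>
      have h1 : dist 1 (conjExp e (((q : ℝ) * T) • a) u) ≤ δ :=
        (ih.trans (mul_le_of_le_one_left dist_nonneg
          (pow_le_one₀ (by norm_num) (by norm_num)))).trans huδ
      have h2 := hcon _ (by rw [h.log_conjExp, hu]) h1
      rw [← h.conjExp_add, ← add_smul] at h2
      have e1 : (q : ℝ) * T + T = ((q + 1 : ℕ) : ℝ) * T := by push_cast; ring
      rw [e1] at h2
      rw [pow_succ]
      linarith
  set q := ⌊s / T⌋₊
  have hq1 : q * T ≤ s := by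
    have := Nat.floor_le (div_nonneg hs hT.le)
    rwa [le_div_iff₀ hT] at this
  have hq2 : s < (q + 1) * T := by
    have := Nat.lt_floor_add_one (s / T)
    rwa [div_lt_iff₀ hT] at this
  have e1 : s • a = ((q : ℝ) * T) • a + (s - q * T) • a := by rw [← add_smul]; congr 1; ring
  have hr : Real.exp (C * ‖(s - q * T) • a‖) ≤ E := by
    rw [hE, norm_smul, Real.norm_of_nonneg (by linarith)]
    gcongr
    linarith
  have hq := hiter q
  have hqu : (1 / 2 : ℝ) ^ q * dist 1 u ≤ dist 1 u := mul_le_of_le_one_left dist_nonneg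
    (pow_le_one₀ (by norm_num) (by norm_num))
  rw [e1, h.conjExp_add]
  refine (h.dist_one_conjExp_le hg _ ?_).trans ?_
  · calc _ ≤ E * dist 1 u := mul_le_mul hr (hq.trans hqu) dist_nonneg (by positivity)
      _ ≤ δ := by linarith
  · have h3 : (1 / 2 : ℝ) ^ q ≤ 2 * Real.exp (-(Real.log 2 / T * s)) := by
      have h4 : (1 / 2 : ℝ) ^ q = Real.exp (-(q * Real.log 2)) := by
        rw [Real.exp_neg, Real.exp_nat_mul, Real.exp_log (by norm_num), one_div, inv_pow]
      have h5 : (2 : ℝ) * Real.exp (-(Real.log 2 / T * s)) =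
          Real.exp (Real.log 2 + -(Real.log 2 / T * s)) := by
        rw [Real.exp_add, Real.exp_log (by norm_num)]
      rw [h4, h5, Real.exp_le_exp]
      have h6 : Real.log 2 / T * s ≤ Real.log 2 / T * ((q + 1) * T) := by gcongr
      have h7 : Real.log 2 / T * ((q + 1) * T) = (q + 1) * Real.log 2 := by field_simp
      linarith
    calc _ ≤ E * ((1 / 2 : ℝ) ^ q * dist 1 u) := mul_le_mul hr hq dist_nonneg (by positivity)
      _ ≤ E * ((2 * Real.exp (-(Real.log 2 / T * s))) * dist 1 u) := by gcongr
      _ = _ := by ring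

/-- Elements of the kernel become small under the contracting flow after a time proportional to
their norm. -/
theorem exists_conjExp_small (h : IsMetricSplitting e ℓ L) (hg : IsGleasonMetric G C δ)
    (hl : IsLengthGroup G) {a : V} {B c η : ℝ} (hB : 1 ≤ B) (hc : 0 < c) (hη : 0 < η)
    (hcon : ∀ u, ℓ u = 0 → dist 1 u ≤ η → ∀ s, 0 ≤ s →
      dist 1 (conjExp e (s • a) u) ≤ B * Real.exp (-(c * s)) * dist 1 u) {θ : ℝ} (hθ : 0 < θ) :
    ∃ S : ℝ, 0 < S ∧ ∀ u, ℓ u = 0 → ∀ s, S * dist 1 u ≤ s →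
      dist 1 (conjExp e (s • a) u) ≤ θ := by
  have hC := hg.one_le
  have hδ := hg.pos
  have hL := h.one_le
  set ε := η / (L + 1) with hε
  have hε0 : 0 < ε := by positivity
  have hεη : (L + 1) * ε = η := by rw [hε]; field_simp
  have hind : ∀ (s κ : ℝ) (M : ℕ), 0 ≤ s → κ ≤ δ →
      Real.exp (C * (L * (M * ε))) * (B * Real.exp (-(c * s)) * η) ≤ κ →
      ∀ n ≤ M, ∀ g, dist 1 g < (n + 1) * ε →
        dist 1 (conjExp e (s • a) (g * e (-ℓ g))) ≤ (n + 1) * κ := by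
    intro s κ M hs hκδ hκ n
    have hsmall : ∀ g, dist 1 g < ε →
        dist 1 (conjExp e (s • a) (g * e (-ℓ g))) ≤ B * Real.exp (-(c * s)) * η := by
      intro g hgε
      have h1 := h.dist_one_mul_exp_neg_le g
      have h2 : dist 1 (g * e (-ℓ g)) ≤ η := h1.trans (by rw [← hεη]; gcongr)
      exact (hcon _ (h.log_mul_exp_neg g) h2 s hs).trans (by gcongr)
    induction n with
    | zero =>
      intro _ g hgε
      simp only [CharP.cast_eq_zero, zero_add, one_mul] at hgε ⊢
      refine (hsmall g hgε).trans (le_trans ?_ hκ)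
      exact le_mul_of_one_le_left (by positivity) (Real.one_le_exp (by positivity))
    | succ n ih =>
      intro hnM g hgε
      obtain ⟨x, k, rfl, hx, hk⟩ := hl g ((n + 1) * ε) ε (by positivity) hε0
        (by push_cast at hgε; linarith)
      have h1 := ih (by omega) x hx
      have h2 := hsmall k hk
      -- Cocycle rule for kernel components: the contribution of the short factor k is conjugated by
      -- e (-ℓ x), which expands it at most by exp (C L M ε).
      have e1 : x * k * e (-ℓ (x * k)) =
          x * e (-ℓ x) * conjExp e (-ℓ x) (k * e (-ℓ k)) := by
        rw [conjExp, h.log_mul, neg_add_rev, h.map_add, neg_neg, h.map_neg (ℓ x)]; group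
      have hlx : ‖-ℓ x‖ ≤ L * (M * ε) := by
        rw [norm_neg]
        refine (h.norm_log_le x).trans ?_
        have : (n : ℝ) + 1 ≤ M := by exact_mod_cast hnM
        have : dist 1 x ≤ M * ε := hx.le.trans (by gcongr)
        gcongr
      have h3 : Real.exp (C * ‖-ℓ x‖) * dist 1 (conjExp e (s • a) (k * e (-ℓ k))) ≤ κ := by
        refine le_trans ?_ hκ
        gcongr
      have h4 := h.dist_one_conjExp_le hg (-ℓ x) (h3.trans hκδ)
      rw [e1, h.conjExp_mul, h.conjExp_comm]
      refine (dist_one_mul_le _ _).trans ?_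
      push_cast
      linarith
  set θ' := min θ δ with hθ'
  have hθ'0 : 0 < θ' := by positivity
  set r := min η (θ / B) with hr
  have hr0 : 0 < r := by positivity
  set D := B * η / θ' with hD
  have hD0 : 0 < D := by positivity
  -- The three terms pay for the expansion by conjugation, for the number n + 1 of pieces, and for
  -- the constant D. The last uses |u| ≥ r; smaller u are handled directly by `hcon`.
  refine ⟨(C * L + 1 / ε + D / r) / c, by positivity, fun u hu s hs ↦ ?_⟩
  have hs0 : 0 ≤ s := le_trans (by positivity) hs
  rcases le_total (dist 1 u) r with hur | hur
  · have h1 := hcon u hu (hur.trans (min_le_left _ _)) s hs0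
    have h2 : Real.exp (-(c * s)) ≤ 1 := Real.exp_le_one_iff.2 (by simp; positivity)
    have h3 : dist 1 u ≤ θ / B := hur.trans (min_le_right _ _)
    calc _ ≤ _ := h1
      _ ≤ B * 1 * (θ / B) := by gcongr
      _ = θ := by field_simp
  · set n := ⌊dist 1 u / ε⌋₊
    have hn1 : n * ε ≤ dist 1 u := by
      have := Nat.floor_le (show 0 ≤ dist 1 u / ε by positivity)
      rwa [le_div_iff₀ hε0] at this
    have hn2 : dist 1 u < (n + 1) * ε := by
      have := Nat.lt_floor_add_one (dist 1 u / ε)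
      rwa [div_lt_iff₀ hε0] at this
    have hn0 : (0 : ℝ) < n + 1 := by positivity
    have hκ : Real.exp (C * (L * (n * ε))) * (B * Real.exp (-(c * s)) * η) ≤ θ' / (n + 1) := by
      rw [le_div_iff₀ hn0]
      have h1 : (n : ℝ) + 1 ≤ Real.exp (dist 1 u / ε) := by
        refine (Real.add_one_le_exp (n : ℝ)).trans ?_
        rw [Real.exp_le_exp, le_div_iff₀ hε0]
        exact hn1
      have h2 : D ≤ Real.exp (D / r * dist 1 u) := by
        have : D ≤ D / r * dist 1 u := by
          rw [div_mul_eq_mul_div, le_div_iff₀ hr0]; gcongr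
        linarith [Real.add_one_le_exp (D / r * dist 1 u)]
      have h3 : B * η = D * θ' := by rw [hD]; field_simp
      have h4 : (C * L + 1 / ε + D / r) * dist 1 u ≤ c * s := by
        rw [div_mul_eq_mul_div, div_le_iff₀ hc] at hs
        linarith
      calc Real.exp (C * (L * (n * ε))) * (B * Real.exp (-(c * s)) * η) * (n + 1)
          = Real.exp (C * (L * (n * ε))) * Real.exp (-(c * s)) * (n + 1) * D * θ' := by
            linear_combination (Real.exp (C * (L * (n * ε))) * Real.exp (-(c * s)) * (n + 1)) * h3
        _ ≤ Real.exp (C * (L * dist 1 u)) * Real.exp (-(c * s)) * Real.exp (dist 1 u / ε) *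
            Real.exp (D / r * dist 1 u) * θ' := by gcongr
        _ = Real.exp ((C * L + 1 / ε + D / r) * dist 1 u - c * s) * θ' := by
            rw [← Real.exp_add, ← Real.exp_add, ← Real.exp_add]; congr 2; ring
        _ ≤ 1 * θ' := by gcongr; rw [Real.exp_le_one_iff]; linarith
        _ = θ' := one_mul _
    have h5 : θ' / (n + 1) ≤ δ := by
      have : θ' / (n + 1) ≤ θ' := div_le_self hθ'0.le (by
        linarith [(Nat.cast_nonneg n : (0 : ℝ) ≤ n)])
      exact this.trans (min_le_right _ _)
    have h6 := hind s (θ' / (n + 1)) n hs0 h5 hκ n le_rfl u hn2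
    rw [hu, neg_zero, h.map_zero, mul_one, mul_div_cancel₀ _ hn0.ne'] at h6
    exact h6.trans (min_le_left _ _)

/-- Coning off small elements of the kernel by means of the contracting flow. -/
theorem exists_dist_conjExp_log_le (h : IsMetricSplitting e ℓ L) (hg : IsGleasonMetric G C δ)
    {a : V} {B c η : ℝ} (hB : 1 ≤ B) (hc : 0 < c)
    (hcon : ∀ u, ℓ u = 0 → dist 1 u ≤ η → ∀ s, 0 ≤ s →
      dist 1 (conjExp e (s • a) u) ≤ B * Real.exp (-(c * s)) * dist 1 u) :
    ∃ D : ℝ, 1 ≤ D ∧ ∀ u, ℓ u = 0 → dist 1 u ≤ η → B * dist 1 u ≤ δ → ∀ σ σ', 0 < σ' → σ' ≤ σ →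
      σ ≤ 1 → dist (conjExp e ((-Real.log σ / c) • a) u) (conjExp e ((-Real.log σ' / c) • a) u) ≤
        D * dist 1 u * (σ - σ') := by
  have hC := hg.one_le
  have hδ := hg.pos
  set Q := (C * B + 2 * B / δ) * ‖a‖ * (2 / c) with hQ
  have hQ0 : 0 ≤ Q := by positivity
  refine ⟨4 * B + Q, by linarith, fun u hu huη huδ σ σ' hσ' hle hσ1 ↦ ?_⟩
  have hσ : 0 < σ := hσ'.trans_le hle
  have hlogσ : Real.log σ ≤ 0 := Real.log_nonpos hσ.le hσ1
  have hlogle : Real.log σ' ≤ Real.log σ := Real.log_le_log hσ' hle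
  have hN : ∀ ς, 0 < ς → ς ≤ 1 →
      dist 1 (conjExp e ((-Real.log ς / c) • a) u) ≤ B * ς * dist 1 u := by
    intro ς hς hς1
    have h1 := hcon u hu huη (-Real.log ς / c)
      (div_nonneg (by linarith [Real.log_nonpos hς.le hς1]) hc.le)
    have e1 : -(c * (-Real.log ς / c)) = Real.log ς := by field_simp
    rwa [e1, Real.exp_log hς] at h1
  have hNσ := hN σ hσ hσ1
  have hNσ' := hN σ' hσ' (hle.trans hσ1)
  set w := conjExp e ((-Real.log σ / c) • a) u with hw
  set w' := conjExp e ((-Real.log σ' / c) • a) u with hw'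
  have hd : (0 : ℝ) ≤ dist 1 u := dist_nonneg
  have hcrude : dist w w' ≤ 2 * B * σ * dist 1 u := by
    have h1 : dist w w' ≤ dist 1 w + dist 1 w' := by
      rw [dist_comm 1 w]; exact dist_triangle _ _ _
    have h2 : B * σ' * dist 1 u ≤ B * σ * dist 1 u := by gcongr
    linarith
  -- If σ' ≤ σ/2, then σ ≤ 2(σ - σ') and the triangle inequality suffices. Otherwise the elapsed
  -- time τ is at most (2/c)(σ - σ')/σ.
  rcases le_total σ' (σ / 2) with hcase | hcase
  · calc _ ≤ _ := hcrude
      _ = 2 * B * dist 1 u * σ := by ring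
      _ ≤ 2 * B * dist 1 u * (2 * (σ - σ')) := by gcongr; linarith
      _ = 4 * B * dist 1 u * (σ - σ') := by ring
      _ ≤ _ := by gcongr; linarith
  · set τ := (Real.log σ - Real.log σ') / c with hτ
    have hτ0 : 0 ≤ τ := div_nonneg (by linarith) hc.le
    have hww : w' = conjExp e (τ • a) w := by
      rw [hw, hw', ← h.conjExp_add, ← add_smul]; congr 2; rw [hτ]; ring
    have hx : dist 1 (e (τ • a)) ≤ τ * ‖a‖ := by
      refine (h.dist_le _).trans_eq ?_
      rw [norm_smul, Real.norm_of_nonneg hτ0]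
    have hwδ : dist 1 w ≤ δ := hNσ.trans (le_trans (by
      calc B * σ * dist 1 u ≤ B * 1 * dist 1 u := by gcongr
        _ = B * dist 1 u := by ring) huδ)
    have hτle : τ ≤ 2 / c * ((σ - σ') / σ) := by
      have h1 : Real.log σ - Real.log σ' ≤ σ / σ' - 1 := by
        rw [← Real.log_div hσ.ne' hσ'.ne']
        exact Real.log_le_sub_one_of_pos (by positivity)
      have h2 : σ / σ' - 1 ≤ 2 * ((σ - σ') / σ) := by
        have e1 : σ / σ' - 1 = (σ - σ') / σ' := by field_simp
        have e2 : 2 * ((σ - σ') / σ) = (σ - σ') / (σ / 2) := by field_simp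
        rw [e1, e2]
        gcongr
      calc τ ≤ (2 * ((σ - σ') / σ)) / c := by rw [hτ]; gcongr; linarith
        _ = _ := by ring
    -- The displacement of w is a commutator with e (τ • a), of size about τ times |w| ≤ Bσ|u|; this
    -- σ cancels the 1/σ in the bound for τ. For long times the crude bound is enough.
    have hmain : dist w w' ≤ (C * B + 2 * B / δ) * (τ * ‖a‖) * (σ * dist 1 u) := by
      rcases le_total (τ * ‖a‖) δ with hcase2 | hcase2
      · have h1 : dist w w' = dist (e (τ • a) * w) (w * e (τ • a)) := by
          rw [hww, h.conjExp_eq, ← dist_mul_left (e (τ • a)) w]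
          congr 1
          group
        have h2 := hg.commutator (e (τ • a)) w (hx.trans hcase2) hwδ
        rw [h1]
        calc _ ≤ _ := h2
          _ ≤ C * (τ * ‖a‖) * (B * σ * dist 1 u) := by gcongr
          _ = (C * B) * (τ * ‖a‖) * (σ * dist 1 u) := by ring
          _ ≤ _ := by gcongr; linarith [show 0 ≤ 2 * B / δ by positivity]
      · calc _ ≤ _ := hcrude
          _ = (2 * B / δ) * δ * (σ * dist 1 u) := by field_simp
          _ ≤ (C * B + 2 * B / δ) * (τ * ‖a‖) * (σ * dist 1 u) := by
            gcongr; linarith [show 0 ≤ C * B by positivity]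
    calc _ ≤ _ := hmain
      _ ≤ (C * B + 2 * B / δ) * (2 / c * ((σ - σ') / σ) * ‖a‖) * (σ * dist 1 u) := by gcongr
      _ = Q * dist 1 u * (σ - σ') := by rw [hQ]; field_simp
      _ ≤ _ := by gcongr; linarith

end IsMetricSplitting

/-! ### Polar coordinates on the disk and filling spans -/

/-- The direction of a point of the disk, with an arbitrary choice at the origin. -/
noncomputable def diskDirection (w : ℂ) : Metric.sphere (0 : ℂ) 1 :=
  if h : w = 0 then ⟨1, by simp⟩ else ⟨w / ‖w‖, by simp [h]⟩

theorem norm_mul_coe_diskDirection (w : ℂ) : (‖w‖ : ℂ) * diskDirection w = w := by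
  unfold diskDirection
  split_ifs with h
  · simp [h]
  · have : (‖w‖ : ℂ) ≠ 0 := by simpa using h
    field_simp

theorem diskDirection_of_mem_sphere (z : Metric.sphere (0 : ℂ) 1) : diskDirection z = z := by
  have h := norm_mul_coe_diskDirection (z : ℂ)
  have hz : ‖(z : ℂ)‖ = 1 := by simp
  rw [hz] at h
  exact Subtype.ext (by simpa using h)

/-- A map defined in polar coordinates, Lipschitz in the radial direction and with radius times
Lipschitz angular dependence, is Lipschitz on the disk. -/
theorem lipschitzWith_polar {X : Type*} [PseudoMetricSpace X] {F : ℝ → Metric.sphere (0 : ℂ) 1 → X}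
    {B : ℝ≥0}
    (hr : ∀ z r r', 0 ≤ r' → r' ≤ r → r ≤ 1 → dist (F r z) (F r' z) ≤ B * (r - r'))
    (hz : ∀ r z z', 0 ≤ r → r ≤ 1 → dist (F r z) (F r z') ≤ B * r * dist z z') :
    LipschitzWith (3 * B)
      (fun w : Metric.closedBall (0 : ℂ) 1 ↦ F ‖(w : ℂ)‖ (diskDirection w)) := by
  have key : ∀ w w' : Metric.closedBall (0 : ℂ) 1, ‖(w' : ℂ)‖ ≤ ‖(w : ℂ)‖ →
      dist (F ‖(w : ℂ)‖ (diskDirection w)) (F ‖(w' : ℂ)‖ (diskDirection w')) ≤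
        3 * B * dist w w' := by
    intro w w' hle
    have hw1 : ‖(w : ℂ)‖ ≤ 1 := mem_closedBall_zero_iff.1 w.2
    have h1 := hr (diskDirection w) ‖(w : ℂ)‖ ‖(w' : ℂ)‖ (norm_nonneg _) hle hw1
    have h2 := hz ‖(w' : ℂ)‖ (diskDirection w) (diskDirection w') (norm_nonneg _) (hle.trans hw1)
    have hd : dist w w' = ‖(w : ℂ) - w'‖ := by rw [Subtype.dist_eq, dist_eq_norm]
    have h3 : ‖(w : ℂ)‖ - ‖(w' : ℂ)‖ ≤ ‖(w : ℂ) - w'‖ := norm_sub_norm_le _ _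
    have h4 : ‖(w' : ℂ)‖ * dist (diskDirection w) (diskDirection w') ≤ 2 * ‖(w : ℂ) - w'‖ := by
      rw [Subtype.dist_eq, dist_eq_norm]
      have e1 : ‖(w' : ℂ)‖ * ‖(diskDirection w : ℂ) - diskDirection w'‖ =
          ‖(‖(w' : ℂ)‖ : ℂ) * diskDirection w - w'‖ := by
        rw [show (‖(w' : ℂ)‖ : ℂ) * diskDirection w - w' =
            (‖(w' : ℂ)‖ : ℂ) * ((diskDirection w : ℂ) - diskDirection w') by
          rw [mul_sub, norm_mul_coe_diskDirection], norm_mul, Complex.norm_real, norm_norm]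
      have e2 : ‖(‖(w' : ℂ)‖ : ℂ) * diskDirection w - w‖ = ‖(w : ℂ)‖ - ‖(w' : ℂ)‖ := by
        rw [show (‖(w' : ℂ)‖ : ℂ) * diskDirection w - w =
            ((‖(w' : ℂ)‖ - ‖(w : ℂ)‖ : ℝ) : ℂ) * diskDirection w by
          rw [Complex.ofReal_sub, sub_mul, norm_mul_coe_diskDirection (w : ℂ)], norm_mul,
          norm_eq_of_mem_sphere, mul_one, Complex.norm_real, Real.norm_of_nonpos (by linarith)]
        ring
      rw [e1]
      have e4 := norm_sub_le_norm_sub_add_norm_sub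
        ((‖(w' : ℂ)‖ : ℂ) * diskDirection w) (w : ℂ) (w' : ℂ)
      linarith
    -- Move radially from w to the circle of w', then along it. The second leg is at most twice ‖w -
    -- w'‖, whence the 3. At the origin the angular bound is 0, so the arbitrary direction is
    -- harmless.
    calc _ ≤ _ := dist_triangle _ (F ‖(w' : ℂ)‖ (diskDirection w)) _
      _ ≤ B * (‖(w : ℂ)‖ - ‖(w' : ℂ)‖) +
          B * (‖(w' : ℂ)‖ * dist (diskDirection w) (diskDirection w')) := by
        rw [← mul_assoc]; exact add_le_add h1 h2
      _ ≤ B * ‖(w : ℂ) - w'‖ + B * (2 * ‖(w : ℂ) - w'‖) := by gcongr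
      _ = 3 * B * dist w w' := by rw [hd]; ring
  refine LipschitzWith.of_dist_le_mul fun w w' ↦ ?_
  push_cast
  rcases le_total ‖(w' : ℂ)‖ ‖(w : ℂ)‖ with h | h
  · exact key w w' h
  · rw [dist_comm, dist_comm w]; exact key w' w h

/-- A space in which every `K`-Lipschitz loop has a `C * K`-Lipschitz filling is Lipschitz
1-connected. -/
theorem lipschitzOneConnected_of_forall_exists {X : Type*} [PseudoEMetricSpace X] {C : ℝ≥0}
    (h : ∀ (K : ℝ≥0) (γ : Metric.sphere (0 : ℂ) 1 → X), LipschitzWith K γ →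
      ∃ f : Metric.closedBall (0 : ℂ) 1 → X, IsFilling γ f ∧ LipschitzWith (C * K) f) :
    LipschitzOneConnected X := by
  -- A nonzero constant is needed to move the product inside the infima.
  refine ⟨C + 1, fun γ _ ↦ ?_⟩
  rw [lipConst, ENNReal.mul_iInf_of_ne (by simp) (by simp)]
  refine le_iInf fun K ↦ ?_
  rw [ENNReal.mul_iInf_of_ne (by simp) (by simp)]
  refine le_iInf fun hK ↦ ?_
  obtain ⟨f, hf, hfl⟩ := h K γ hK
  calc fillingSpan γ ≤ lipConst f := iInf₂_le f hf
    _ ≤ ((C * K : ℝ≥0) : ℝ≥0∞) := iInf₂_le (C * K) hfl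
    _ ≤ _ := by rw [ENNReal.coe_mul]; gcongr; exact_mod_cast le_self_add

/-! ### Construction of the filling -/

namespace IsMetricSplitting

variable {G V : Type*} [Group G] [MetricSpace G] [NormedAddCommGroup V] {e : V → G} {ℓ : G → V}
  {L : ℝ} {C δ : ℝ}

theorem conjExp_exp (h : IsMetricSplitting e ℓ L) (v w : V) : conjExp e v (e w) = e w := by
  rw [conjExp, ← h.map_add, ← h.map_add]; congr 1; abel

variable [IsIsometricSMul G G]

/-- Right translations by the contracting flow are uniformly Lipschitz. -/
theorem exists_dist_one_conjExp_le_mul [NormedSpace ℝ V] (h : IsMetricSplitting e ℓ L) (hl : IsLengthGroup G)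
    {a : V} {B c η : ℝ} (hB : 1 ≤ B) (hc : 0 < c) (hη : 0 < η)
    (hcon : ∀ u, ℓ u = 0 → dist 1 u ≤ η → ∀ s, 0 ≤ s →
      dist 1 (conjExp e (s • a) u) ≤ B * Real.exp (-(c * s)) * dist 1 u) :
    ∃ R : ℝ, 0 ≤ R ∧ ∀ s : ℝ, 0 ≤ s → ∀ g, dist 1 (conjExp e (s • a) g) ≤ R * dist 1 g := by
  have hL := h.one_le
  refine ⟨B * (L + 1) + L, by positivity, fun s hs ↦ hl.le_mul_of_subadditive
    (ε := η / (L + 1)) (fun x y ↦ ?_) (by positivity) (by positivity) fun g hg ↦ ?_⟩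
  · rw [h.conjExp_mul]; exact dist_one_mul_le _ _
  · rw [lt_div_iff₀ (by positivity)] at hg
    have h1 := h.dist_one_mul_exp_neg_le g
    have h2 := hcon _ (h.log_mul_exp_neg g) (by linarith) s hs
    have h3 : Real.exp (-(c * s)) ≤ 1 := Real.exp_le_one_iff.2 (by simp; positivity)
    -- The flow contracts the kernel factor up to the constant B and fixes the other, since e has
    -- commutative image.
    have e1 : g = g * e (-ℓ g) * e (ℓ g) := by
      rw [mul_assoc, ← h.map_add, neg_add_cancel, h.map_zero, mul_one]
    have h4 : dist 1 (conjExp e (s • a) g) ≤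
        dist 1 (conjExp e (s • a) (g * e (-ℓ g))) + dist 1 (e (ℓ g)) := by
      conv_lhs => rw [e1, h.conjExp_mul, h.conjExp_exp]
      exact dist_one_mul_le _ _
    have h5 : B * Real.exp (-(c * s)) * dist 1 (g * e (-ℓ g)) ≤ B * 1 * ((L + 1) * dist 1 g) := by
      gcongr
    linarith [h.dist_le (ℓ g), h.norm_log_le g]

/-- Conjugation by small elements is uniformly Lipschitz. -/
theorem _root_.IsGleasonMetric.dist_one_conj_le_mul (hg : IsGleasonMetric G C δ)
    (hl : IsLengthGroup G) {w : G} (hw : dist 1 w ≤ δ) (x : G) :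
    dist 1 (w⁻¹ * x * w) ≤ (1 + C * δ) * dist 1 x := by
  have hC := hg.one_le
  have hδ := hg.pos
  refine hl.le_mul_of_subadditive (f := fun x ↦ dist 1 (w⁻¹ * x * w)) (ε := δ) (fun x y ↦ ?_)
    (by positivity) hδ (fun x hx ↦ ?_) x
  · have e1 : w⁻¹ * (x * y) * w = (w⁻¹ * x * w) * (w⁻¹ * y * w) := by group
    rw [e1]
    exact dist_one_mul_le _ _
  · exact (hg.dist_one_conj_le hw hx.le).trans (by gcongr)

/-- By left invariance only e (y - x) conjugated by the small element w is left, so right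
multiplication by w distorts distances along e(V) by at most 1 + Cδ. -/
theorem dist_exp_mul_le (h : IsMetricSplitting e ℓ L) (hg : IsGleasonMetric G C δ)
    (hl : IsLengthGroup G) {w : G} (hw : dist 1 w ≤ δ) (x y : V) :
    dist (e x * w) (e y * w) ≤ (1 + C * δ) * ‖x - y‖ := by
  have hC := hg.one_le
  have hδ := hg.pos
  have e1 : (e x * w)⁻¹ * (e y * w) = w⁻¹ * e (-x + y) * w := by
    rw [h.map_add, h.map_neg]; group
  rw [dist_eq_dist_one_inv_mul, e1]
  refine (hg.dist_one_conj_le_mul hl hw _).trans ?_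
  gcongr
  refine (h.dist_le _).trans_eq ?_
  rw [← norm_neg]; congr 1; abel

end IsMetricSplitting

/-- A length group with a Gleason metric and a metric splitting whose kernel is contracted by the
conjugation by some exponential is Lipschitz 1-connected. -/
theorem IsMetricSplitting.lipschitzOneConnected {G V : Type*} [Group G] [MetricSpace G]
    [IsIsometricSMul G G] [NormedAddCommGroup V] [NormedSpace ℝ V] {e : V → G} {ℓ : G → V}
    {L C δ : ℝ} (h : IsMetricSplitting e ℓ L) (hg : IsGleasonMetric G C δ) (hl : IsLengthGroup G)
    {a : V} {T : ℝ} (hT : 0 < T)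
    (hcon : ∀ u, ℓ u = 0 → dist 1 u ≤ δ → dist 1 (conjExp e (T • a) u) ≤ dist 1 u / 2) :
    LipschitzOneConnected G := by
  have hC := hg.one_le
  have hδ := hg.pos
  have hL := h.one_le
  obtain ⟨B, c, η, hB, hc, hη, hexp⟩ := h.exists_exp_contraction hg hT hcon
  obtain ⟨R, hR, hRg⟩ := h.exists_dist_one_conjExp_le_mul hl hB hc hη hexp
  -- The factor 1/2 puts quotients of two θ-small elements within η; Bθ ≤ δ keeps the flowed
  -- elements where the Gleason estimates hold.
  set θ := min (η / 2) (δ / B) with hθ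
  have hθ0 : 0 < θ := by positivity
  have hθη : 2 * θ ≤ η := by linarith [min_le_left (η / 2) (δ / B)]
  have hθδ : B * θ ≤ δ := by
    have := min_le_right (η / 2) (δ / B)
    rw [← hθ, le_div_iff₀ (by positivity)] at this
    linarith
  obtain ⟨S₀, hS₀, hsmall⟩ := h.exists_conjExp_small hg hl hB hc hη hexp hθ0
  obtain ⟨D, hD, hcone⟩ := h.exists_dist_conjExp_log_le hg hB hc hexp
  set P := 1 + C * δ with hP
  have hP1 : 1 ≤ P := by rw [hP]; nlinarith
  set Q := R + P * L with hQ
  have hQ0 : 0 ≤ Q := by positivity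
  -- The sum of the bounds met below: radial inner (two terms), radial outer, angular inner, angular
  -- outer.
  set M : ℝ := 4 * ((D + B) * Q) + 4 * (P * L) + 4 * (S₀ * (L + 1) * ‖a‖) + 2 * (B * Q + P * L) +
    2 * R with hM
  have hM0 : 0 ≤ M := by positivity
  refine lipschitzOneConnected_of_forall_exists (C := 3 * M.toNNReal) fun K γ hγ ↦ ?_
  have hK0 : (0 : ℝ) ≤ K := K.coe_nonneg
  set g₀ : G := γ ⟨1, by simp⟩ with hg₀
  set β : Metric.sphere (0 : ℂ) 1 → G := fun z ↦ g₀⁻¹ * γ z with hβ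
  have hβd : ∀ z z', dist 1 ((β z)⁻¹ * β z') ≤ K * dist z z' := fun z z' ↦ by
    rw [← dist_eq_dist_one_inv_mul, hβ, dist_mul_left]
    exact hγ.dist_le_mul z z'
  have hβ1 : β ⟨1, by simp⟩ = 1 := by simp [hβ, hg₀]
  have hdiam : ∀ z z' : Metric.sphere (0 : ℂ) 1, dist z z' ≤ 2 := fun z z' ↦ by
    rw [Subtype.dist_eq, dist_eq_norm]
    refine (norm_sub_le _ _).trans ?_
    rw [norm_eq_of_mem_sphere, norm_eq_of_mem_sphere]
    norm_num
  have hβn : ∀ z, dist 1 (β z) ≤ 2 * K := fun z ↦ by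
    have h1 := hβd ⟨1, by simp⟩ z
    rw [hβ1, inv_one, one_mul] at h1
    exact h1.trans (by nlinarith [hdiam ⟨1, by simp⟩ z])
  set α : Metric.sphere (0 : ℂ) 1 → V := fun z ↦ ℓ (β z) with hα
  have hαd : ∀ z z', ‖α z - α z'‖ ≤ L * (K * dist z z') := fun z z' ↦ by
    have h1 := h.norm_log_le ((β z)⁻¹ * β z')
    rw [h.log_mul, h.log_inv, ← sub_eq_neg_add, norm_sub_rev] at h1
    exact h1.trans (by gcongr; exact hβd z z')
  have hαn : ∀ z, ‖α z‖ ≤ 2 * L * K := fun z ↦ by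
    have h1 := h.norm_log_le (β z)
    have h2 := mul_le_mul_of_nonneg_left (hβn z) (show 0 ≤ L by linarith)
    exact h1.trans (by linarith)
  -- 2(L + 1)K bounds the norm of the kernel part e (-α z) * β z of the loop.
  set S := S₀ * (2 * (L + 1) * K) with hS
  have hS0 : 0 ≤ S := by positivity
  set v : Metric.sphere (0 : ℂ) 1 → G := fun z ↦ conjExp e (S • a) (e (-α z) * β z) with hv
  have hvℓ : ∀ z, ℓ (v z) = 0 := fun z ↦ by
    rw [hv, h.log_conjExp, h.log_mul, h.log_exp, neg_add_cancel]
  have hvθ : ∀ z, dist 1 (v z) ≤ θ := fun z ↦ by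
    refine hsmall _ (by rw [h.log_mul, h.log_exp, neg_add_cancel]) S ?_
    rw [hS]
    gcongr
    have h1 := dist_one_mul_le (e (-α z)) (β z)
    have h2 := h.dist_le (-α z)
    rw [norm_neg] at h2
    linarith [hαn z, hβn z]
  have hBθ : θ ≤ B * θ := le_mul_of_one_le_left hθ0.le hB
  have hEv : ∀ z, e (α z + S • a) * v z = β z * e (S • a) := fun z ↦ by
    simp only [hv, h.conjExp_eq, h.map_add, h.map_neg]; group
  have hβS : ∀ s : ℝ, 0 ≤ s → ∀ z z', dist (β z * e (s • a)) (β z' * e (s • a)) ≤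
      R * (K * dist z z') := fun s hs z z' ↦ by
    have h1 := hRg s hs ((β z)⁻¹ * β z')
    have e1 : (β z * e (s • a))⁻¹ * (β z' * e (s • a)) = conjExp e (s • a) ((β z)⁻¹ * β z') := by
      rw [h.conjExp_eq]; group
    rw [dist_eq_dist_one_inv_mul, e1]
    exact h1.trans (by gcongr; exact hβd z z')
  have hvd : ∀ z z', dist (v z) (v z') ≤ Q * (K * dist z z') := fun z z' ↦ by
    have h1 := hβS S hS0 z z'
    rw [← hEv, ← hEv] at h1
    have h2 := h.dist_exp_mul_le hg hl ((hvθ z').trans (hBθ.trans hθδ)) (α z' + S • a)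
      (α z + S • a)
    rw [add_sub_add_right_eq_sub, norm_sub_rev] at h2
    have h3 : P * ‖α z - α z'‖ ≤ P * (L * (K * dist z z')) := by gcongr; exact hαd z z'
    rw [← dist_mul_left (e (α z + S • a))]
    have h4 := dist_triangle (e (α z + S • a) * v z) (e (α z' + S • a) * v z')
      (e (α z + S • a) * v z')
    rw [hQ, add_mul, mul_assoc P]
    linarith
  have hv1 : v ⟨1, by simp⟩ = 1 := by
    have : α ⟨1, by simp⟩ = 0 := by rw [hα]; simp only [hβ1, h.log_one]
    simp only [hv, h.conjExp_eq, this, hβ1, neg_zero, h.map_zero]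
    group
  have hvn : ∀ z, dist 1 (v z) ≤ 2 * Q * K := fun z ↦ by
    have h1 := hvd ⟨1, by simp⟩ z
    rw [hv1] at h1
    have h2 : Q * (K * dist ⟨1, by simp⟩ z) ≤ Q * (K * 2) := by gcongr; exact hdiam _ z
    linarith
  set w : ℝ → Metric.sphere (0 : ℂ) 1 → G := fun σ z ↦ conjExp e ((-Real.log σ / c) • a) (v z)
    with hw
  have hflow : ∀ σ, 0 < σ → σ ≤ 1 → ∀ u, ℓ u = 0 → dist 1 u ≤ η →
      dist 1 (conjExp e ((-Real.log σ / c) • a) u) ≤ B * σ * dist 1 u := by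
    intro σ hσ hσ1 u hu huη
    have h1 := hexp u hu huη (-Real.log σ / c)
      (div_nonneg (by linarith [Real.log_nonpos hσ.le hσ1]) hc.le)
    have e1 : -(c * (-Real.log σ / c)) = Real.log σ := by field_simp
    rwa [e1, Real.exp_log hσ] at h1
  have hwn : ∀ σ, 0 < σ → σ ≤ 1 → ∀ z, dist 1 (w σ z) ≤ B * σ * dist 1 (v z) :=
    fun σ hσ hσ1 z ↦ hflow σ hσ hσ1 _ (hvℓ z) (by linarith [hvθ z])
  have hwδ : ∀ σ, 0 < σ → σ ≤ 1 → ∀ z, dist 1 (w σ z) ≤ δ := fun σ hσ hσ1 z ↦ by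
    refine (hwn σ hσ hσ1 z).trans (le_trans ?_ hθδ)
    calc B * σ * dist 1 (v z) ≤ B * 1 * θ := by gcongr; exact hvθ z
      _ = B * θ := by ring
  have hwd : ∀ σ, 0 < σ → σ ≤ 1 → ∀ z z', dist (w σ z) (w σ z') ≤ B * σ * dist (v z) (v z') :=
    fun σ hσ hσ1 z z' ↦ by
    have hn : dist 1 ((v z)⁻¹ * v z') ≤ η := by
      rw [← dist_eq_dist_one_inv_mul]
      have := dist_triangle (v z) 1 (v z')
      rw [dist_comm (v z) 1] at this
      linarith [hvθ z, hvθ z']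
    have h1 := hflow σ hσ hσ1 _ (by rw [h.log_mul, h.log_inv, hvℓ, hvℓ]; simp) hn
    rwa [← h.dist_conjExp, ← dist_eq_dist_one_inv_mul] at h1
  -- At σ = 1 this is the translated loop, at σ = 0 a single point. The apex needs its own clause
  -- because `Real.log 0 = 0` would make w 0 z equal to v z.
  set inner : ℝ → Metric.sphere (0 : ℂ) 1 → G := fun σ z ↦
    if 0 < σ then e (σ • α z + S • a) * w σ z else e (S • a) with hinner
  have hinner_z : ∀ σ, 0 ≤ σ → σ ≤ 1 → ∀ z z', dist (inner σ z) (inner σ z') ≤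
      σ * ((B * Q + P * L) * K) * dist z z' := by
    intro σ hσ hσ1 z z'
    rcases hσ.eq_or_lt with rfl | hσ0
    · simp [hinner]
    · simp only [hinner, if_pos hσ0]
      have h1 := hwd σ hσ0 hσ1 z z'
      have h2 := h.dist_exp_mul_le hg hl (hwδ σ hσ0 hσ1 z') (σ • α z + S • a) (σ • α z' + S • a)
      rw [add_sub_add_right_eq_sub, ← smul_sub, norm_smul, Real.norm_of_nonneg hσ] at h2
      have h3 := dist_triangle (e (σ • α z + S • a) * w σ z) (e (σ • α z + S • a) * w σ z')
        (e (σ • α z' + S • a) * w σ z')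
      rw [dist_mul_left] at h3
      have h4 : B * σ * dist (v z) (v z') ≤ B * σ * (Q * (K * dist z z')) := by
        gcongr; exact hvd z z'
      have h5 : P * (σ * ‖α z - α z'‖) ≤ P * (σ * (L * (K * dist z z'))) := by
        gcongr; exact hαd z z'
      linarith
  have hinner_r : ∀ σ σ', 0 ≤ σ' → σ' ≤ σ → σ ≤ 1 → ∀ z, dist (inner σ z) (inner σ' z) ≤
      (2 * ((D + B) * Q) + 2 * (P * L)) * K * (σ - σ') := by
    intro σ σ' hσ' hle hσ1 z
    have hsum : (D + B) * dist 1 (v z) + P * ‖α z‖ ≤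
        (2 * ((D + B) * Q) + 2 * (P * L)) * K := by
      have h1 : (D + B) * dist 1 (v z) ≤ (D + B) * (2 * Q * K) := by gcongr; exact hvn z
      have h2 : P * ‖α z‖ ≤ P * (2 * L * K) := by gcongr; exact hαn z
      linarith
    refine le_trans ?_ (mul_le_mul_of_nonneg_right hsum (sub_nonneg.2 hle))
    rcases hσ'.eq_or_lt with rfl | hσ'0
    · rcases hle.eq_or_lt with rfl | hσ0
      · simp
      simp only [hinner, if_pos hσ0, lt_irrefl, if_false, sub_zero]
      have h1 : dist (e (σ • α z + S • a) * w σ z) (e (S • a)) ≤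
          dist 1 (w σ z) + ‖σ • α z‖ := by
        have e1 : (e (S • a))⁻¹ * (e (σ • α z + S • a) * w σ z) = e (σ • α z) * w σ z := by
          rw [add_comm, h.map_add]; group
        rw [dist_comm, dist_eq_dist_one_inv_mul, e1]
        linarith [dist_one_mul_le (e (σ • α z)) (w σ z), h.dist_le (σ • α z)]
      rw [norm_smul, Real.norm_of_nonneg hσ0.le] at h1
      have h2 := hwn σ hσ0 hσ1 z
      have h3 : σ * ‖α z‖ ≤ P * (σ * ‖α z‖) := le_mul_of_one_le_left (by positivity) hP1
      have h4 : 0 ≤ D * σ * dist 1 (v z) := by positivity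
      linarith
    · have hσ0 : 0 < σ := hσ'0.trans_le hle
      simp only [hinner, if_pos hσ0, if_pos hσ'0]
      have h1 := hcone (v z) (hvℓ z) (by linarith [hvθ z])
        ((mul_le_mul_of_nonneg_left (hvθ z) (by linarith)).trans hθδ) σ σ' hσ'0 hle hσ1
      have h2 := h.dist_exp_mul_le hg hl (hwδ σ' hσ'0 (hle.trans hσ1) z) (σ • α z + S • a)
        (σ' • α z + S • a)
      rw [add_sub_add_right_eq_sub, ← sub_smul, norm_smul,
        Real.norm_of_nonneg (sub_nonneg.2 hle)] at h2
      have h3 := dist_triangle (e (σ • α z + S • a) * w σ z) (e (σ • α z + S • a) * w σ' z)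
        (e (σ' • α z + S • a) * w σ' z)
      rw [dist_mul_left] at h3
      have h4 : 0 ≤ B * dist 1 (v z) * (σ - σ') := mul_nonneg (by positivity) (sub_nonneg.2 hle)
      change dist (w σ z) (w σ' z) ≤ _ at h1
      linarith
  -- The translation time 2(1 - r)S runs from S at r = 1/2 to 0 on the boundary.
  set outer : ℝ → Metric.sphere (0 : ℂ) 1 → G := fun r z ↦ β z * e ((2 * (1 - r) * S) • a)
    with houter
  have houter_r : ∀ r r' z, r' ≤ r →
      dist (outer r z) (outer r' z) ≤ 4 * (S₀ * (L + 1) * ‖a‖) * K * (r - r') := by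
    intro r r' z hle
    have e1 : (e ((2 * (1 - r) * S) • a))⁻¹ * e ((2 * (1 - r') * S) • a) =
        e ((2 * (r - r') * S) • a) := by
      rw [← h.map_neg, ← h.map_add, ← neg_smul, ← add_smul]; congr 2; ring
    simp only [houter]
    rw [dist_mul_left, dist_eq_dist_one_inv_mul, e1]
    refine (h.dist_le _).trans_eq ?_
    rw [norm_smul, Real.norm_of_nonneg (mul_nonneg (by linarith) hS0), hS]
    ring
  have hglue : ∀ z, outer (1 / 2) z = inner 1 z := fun z ↦ by
    simp only [houter, hinner, one_pos, if_true, hw, Real.log_one, neg_zero, zero_div, zero_smul,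
      h.conjExp_zero, one_smul, hEv]
    norm_num
  set F : ℝ → Metric.sphere (0 : ℂ) 1 → G := fun r z ↦
    g₀ * if r ≤ 1 / 2 then inner (2 * r) z else outer r z with hF
  have hinnerF : ∀ r r' z, 0 ≤ r' → r' ≤ r → r ≤ 1 / 2 →
      dist (inner (2 * r) z) (inner (2 * r') z) ≤
        (4 * ((D + B) * Q) + 4 * (P * L)) * K * (r - r') := fun r r' z hr' hle hr ↦
    (hinner_r (2 * r) (2 * r') (by linarith) (by linarith) (by linarith) z).trans_eq (by ring)
  refine ⟨fun x ↦ F ‖(x : ℂ)‖ (diskDirection x), fun z ↦ ?_, ?_⟩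
  · have hz : ‖(z : ℂ)‖ = 1 := norm_eq_of_mem_sphere z
    simp only [hF, hz, diskDirection_of_mem_sphere]
    rw [if_neg (by norm_num)]
    simp [houter, hβ, h.map_zero]
  have hlip := lipschitzWith_polar (F := F) (B := M.toNNReal * K)
    (fun z r r' hr' hle hr ↦ ?_) (fun r z z' hr hr1 ↦ ?_)
  · rwa [← mul_assoc] at hlip
  · have hin0 : 0 ≤ (4 * ((D + B) * Q) + 4 * (P * L)) * K := by positivity
    have hout0 : 0 ≤ 4 * (S₀ * (L + 1) * ‖a‖) * K := by positivity
    have hMK : (4 * ((D + B) * Q) + 4 * (P * L)) * K + 4 * (S₀ * (L + 1) * ‖a‖) * K ≤ M * K := by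
      rw [← add_mul, hM]
      refine mul_le_mul_of_nonneg_right ?_ hK0
      linarith [show 0 ≤ 2 * (B * Q + P * L) + 2 * R by positivity]
    rw [NNReal.coe_mul, Real.coe_toNNReal M hM0]
    simp only [hF, dist_mul_left]
    refine le_trans ?_ (mul_le_mul_of_nonneg_right hMK (sub_nonneg.2 hle))
    rw [add_mul]
    split_ifs with h1 h2 h2
    · have := hinnerF r r' z hr' hle h1
      have := mul_nonneg hout0 (sub_nonneg.2 hle)
      linarith
    · linarith
    -- For radii on both sides of 1/2, pass through the gluing circle.
    · have i1 := hinnerF (1 / 2) r' z hr' h2 le_rfl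
      have i2 := houter_r r (1 / 2) z (by linarith)
      rw [mul_one_div_cancel two_ne_zero, ← hglue] at i1
      have i3 := dist_triangle (outer r z) (outer (1 / 2) z) (inner (2 * r') z)
      have i4 := mul_le_mul_of_nonneg_left (show 1 / 2 - r' ≤ r - r' by linarith) hin0
      have i5 := mul_le_mul_of_nonneg_left (show r - 1 / 2 ≤ r - r' by linarith) hout0
      linarith
    · have := houter_r r r' z hle
      have := mul_nonneg hin0 (sub_nonneg.2 hle)
      linarith
  · rw [NNReal.coe_mul, Real.coe_toNNReal M hM0]
    simp only [hF, dist_mul_left]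
    split_ifs with h1
    · refine (hinner_z (2 * r) (by linarith) (by linarith) z z').trans ?_
      rw [show 2 * r * ((B * Q + P * L) * K) = 2 * (B * Q + P * L) * K * r by ring]
      gcongr
      rw [hM]
      linarith [show 0 ≤ 4 * ((D + B) * Q) + 4 * (P * L) + 4 * (S₀ * (L + 1) * ‖a‖) + 2 * R by
        positivity]
    · refine (hβS (2 * (1 - r) * S) (mul_nonneg (by linarith) hS0) z z').trans ?_
      -- Here r ≥ 1/2 supplies the factor r required by the polar estimate, at the price of the 2 in
      -- 2R.
      have i1 : R * K * dist z z' * 1 ≤ R * K * dist z z' * (2 * r) := by gcongr; linarith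
      calc R * (K * dist z z') ≤ 2 * R * K * r * dist z z' := by linarith
        _ ≤ M * K * r * dist z z' := by
          gcongr
          rw [hM]
          linarith [show 0 ≤ 4 * ((D + B) * Q) + 4 * (P * L) + 4 * (S₀ * (L + 1) * ‖a‖) +
            2 * (B * Q + P * L) by positivity]

/-! ### Assembly -/

theorem proposition4p3
    {E : Type*} [NormedAddCommGroup E] [NormedSpace ℝ E] [FiniteDimensional ℝ E]
    {G : Type*} [Group G] [MetricSpace G] [ChartedSpace E G] [LieGroup 𝓘(ℝ, E) ∞ G]
    [Bundle.RiemannianBundle (fun x : G ↦ TangentSpace 𝓘(ℝ, E) x)]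
    [IsContMDiffRiemannianBundle 𝓘(ℝ, E) ∞ E (fun x : G ↦ TangentSpace 𝓘(ℝ, E) x)]
    [IsRiemannianManifold 𝓘(ℝ, E) G]
    (hG : IsLeftInvariantMetric E G)
    (U A : Subgroup G) (hUA : IsUnipotentByAbelian U A) (htame : IsTame U A) :
    LipschitzOneConnected G := by
  have hiso : IsIsometricSMul G G := isIsometricSMul_of_isLeftInvariantMetric hG
  have hl : IsLengthGroup G := isLengthGroup_of_isLeftInvariantMetric hG
  obtain ⟨C, δ, hg⟩ := exists_isGleasonMetric_of_isLeftInvariantMetric hG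
  have htop : IsTopologicalGroup G := topologicalGroup_of_lieGroup 𝓘(ℝ, E) ∞
  have hlc : LocallyCompactSpace G := Manifold.locallyCompact_of_finiteDimensional 𝓘(ℝ, E)
  have hproper : ProperSpace G := hl.properSpace
  obtain ⟨pr, hpr, hprA, hker⟩ := exists_continuous_projection hUA.isClosed_left
    hUA.isClosed_right hUA.normal hUA.isComplement
  have hcomm := hUA.comm
  have hcontr := hUA.contractible_right
  -- Built on the existing group structure of A, so that the restricted metric and the inclusion
  -- into G stay compatible with it.
  let _ : CommGroup A := { A.toGroup with mul_comm := hcomm.is_comm.comm }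
  have hisoA : IsIsometricSMul A A := ⟨fun a x y ↦ edist_mul_left (a : G) (x : G) (y : G)⟩
  have hproperA : ProperSpace A := ProperSpace.of_isClosed hUA.isClosed_right
  obtain ⟨e, ℓ, L, hsplit, hℓ, he⟩ := exists_isMetricSplitting (ι := A.subtype) hl (hg.subgroup A)
    hpr isometry_subtype_coe hprA
  obtain ⟨a, haA, Ω, hΩ⟩ := htame
  obtain ⟨n, hn, hhalf⟩ := hΩ.exists_dist_one_conj_le_half hg hUA.isClosed_left hUA.unipotent
  have hea : e (ℓ a) = a := he ⟨a, haA⟩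
  have hean : ∀ k : ℕ, e ((k : ℝ) • ℓ a) = a ^ k := by
    intro k
    induction k with
    | zero => simp [hsplit.map_zero]
    | succ k ih => rw [Nat.cast_succ, add_smul, one_smul, hsplit.map_add, ih, hea, pow_succ]
  -- Since e (n • ℓ a) = a ^ n, time n along ℓ a is the contracting conjugation.
  refine hsplit.lipschitzOneConnected hg hl (a := ℓ a) (T := n) (by exact_mod_cast hn)
    fun u hu huδ ↦ ?_
  have huU : u ∈ U := by rw [← hker, MonoidHom.mem_ker, ← hℓ, hu]
  rw [hsplit.conjExp_eq, hean]
  exact hhalf u huU huδ
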